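/- Let $(\Omega,\mathcal A,P)$ be a separable probability space that is rich enough to carry independent sequences (i.e. every sequence of probability laws on $\mathbb R$ is the sequence of laws of some independent random variables on $\Omega$), and let $\xi,\eta\ge 0$ be real random variables on $\Omega$. An Orlicz function is a continuous, nondecreasing, convex $\varphi:[0,\infty)\to[0,\infty)$ with $\varphi(0)=0$ and $\lim_{x\to\infty}\varphi(x)=\infty$, and $\|f\|_\varphi=\inf\{r>0: E\varphi(|f|/r)\le 1\}$ (with $\inf\emptyset=\infty$). For $t>0$ let $\varphi_t(x)=(x-1)_+/t$. Put $f^*(u)=\sup\{s\ge 0:P(|f|\ge s)>u\}$ (with $\sup\emptyset=0$) and $f^{**}(t)=\frac1t\int_0^t f^*(u)\,du\in[0,\infty]$ for $t>0$. A rearrangement invariant (r.i.) norm is the norm of a Banach space $L$ of random variables on $\Omega$ (identified when almost surely equal), extended by $\|f\|=\infty$ for $f\notin L$, such that: if $|f|\le|g|$ a.s. then $\|f\|\le\|g\|$; $\|f\|$ depends only on the distribution of $f$; $L^\infty\subset L\subset L^1$ with bounded inclusions; the associate space $L'$, with norm $\|g\|_{L'}=\sup\{E|fg|:\|f\|\le1\}$,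 is norming, i.e. $\|f\|=\|f\|_{L''}$ for $f\in L$; and $L$ is either maximal ($L=L''$) or minimal (simple random variables are dense in $L$). The r.i. norm is separable if $L$ is a separable Banach space. In each of the following cases let $c_i\in[0,\infty]$ be the infimum of all finite constants $c\ge0$ with the stated property (with $\inf\emptyset=\infty$ and $0\cdot\infty=0$): 1. $c_1$: $\|\xi\|_\varphi\le c\,\|\eta\|_\varphi$ for every Orlicz function $\varphi$; 2. $c_2$: $\|\xi\|_{\varphi_t}\le c\,\|\eta\|_{\varphi_t}$ for every $t>0$; 3. $c_3$: $\xi^{**}(t)\le c\,\eta^{**}(t)$ for every $t>0$; 4. $c_4$: $\|\xi\|\le c\,\|\eta\|$ for every r.i. norm on $\Omega$; 5. $c_5$: $\|\xi\|\le c\,\|\eta\|$ for every separable r.i. norm on $\Omega$. Then $$c_1=c_2\le c_3=c_4=c_5\le 2c_1 .$$ Moreover, if $\eta$ is integrable, then each of these infima that is finite is attained, so that $c_i$ is the smallest constant with the stated property. -/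

import Mathlib

open MeasureTheory ProbabilityTheory Filter Topology
open scoped ENNReal NNReal

noncomputable section

namespace Domination

variable {Ω : Type*} [MeasurableSpace Ω]

/-- The probability space is rich enough to carry independent sequences: every sequence of
probability laws on the line is the sequence of laws of some independent random variables. -/
def CarriesIndependentSequences (P : Measure Ω) : Prop :=
  ∀ ν : ℕ → Measure ℝ, (∀ n, IsProbabilityMeasure (ν n)) →
    ∃ X : ℕ → Ω → ℝ, (∀ n, Measurable (X n)) ∧ iIndepFun X P ∧ ∀ n, P.map (X n) = ν n

/-! ### Orlicz norms -/

/-- Orlicz functions; only the values on `[0, ∞)` matter. They may vanish near `0`. -/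
structure IsOrliczFunction (φ : ℝ → ℝ) : Prop where
  map_zero : φ 0 = 0
  continuousOn : ContinuousOn φ (Set.Ici 0)
  monotoneOn : MonotoneOn φ (Set.Ici 0)
  convexOn : ConvexOn ℝ (Set.Ici 0) φ
  tendsto_atTop : Tendsto φ atTop atTop

/-- The Luxemburg norm `inf {r > 0 : E φ(|f| / r) ≤ 1}`, equal to `∞` if there is no such `r`. -/
def orliczNorm (P : Measure Ω) (φ : ℝ → ℝ) (f : Ω → ℝ) : ℝ≥0∞ :=
  ⨅ (r : ℝ) (_ : 0 < r) (_ : ∫⁻ ω, ENNReal.ofReal (φ (|f ω| / r)) ∂P ≤ 1), ENNReal.ofReal r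

/-- The special Orlicz function `φ_t(x) = (x - 1)₊ / t`. -/
def specialOrlicz (t : ℝ) (x : ℝ) : ℝ := max (x - 1) 0 / t

/-! ### Decreasing rearrangement and maximal function -/

/-- `f*(u) = sup {s ≥ 0 : P(|f| ≥ s) > u}`, the supremum of the empty set being `0`. -/
def rearrangement (P : Measure Ω) (f : Ω → ℝ) (u : ℝ) : ℝ≥0∞ :=
  ⨆ (s : ℝ≥0) (_ : ENNReal.ofReal u < P {ω | (s : ℝ) ≤ |f ω|}), (s : ℝ≥0∞)

/-- `f**(t) = (1 / t) ∫₀ᵗ f*(u) du`, used for `t > 0` only. -/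
def maximalFunction (P : Measure Ω) (f : Ω → ℝ) (t : ℝ) : ℝ≥0∞ :=
  (∫⁻ u in Set.Ioc 0 t, rearrangement P f u) / ENNReal.ofReal t

/-! ### Rearrangement invariant norms

A norm is given as an extended functional `N` on random variables; the function space is
`{f : N f < ∞}`, and random variables outside the space have norm `∞`. -/

/-- The associate (Köthe dual) functional: `N'(g) = sup {E |f g| : N f ≤ 1}`. -/
def associate (P : Measure Ω) (N : (Ω → ℝ) → ℝ≥0∞) (g : Ω → ℝ) : ℝ≥0∞ :=
  ⨆ (f : Ω → ℝ) (_ : AEMeasurable f P) (_ : N f ≤ 1), ∫⁻ ω, ‖f ω * g ω‖ₑ ∂P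

/-- `N` is the norm of a rearrangement invariant function space `L = {f : N f < ∞}` over `P`:
a Banach lattice norm (monotone for `|f| ≤ |g|` a.s.) with `L^∞ ⊆ L ⊆ L^1` that depends only on
the distribution, such that the associate space `L'` is norming and `L` is either
maximal (`L = L''`) or minimal (the simple functions are dense in `L`). -/
structure IsRINorm (P : Measure Ω) (N : (Ω → ℝ) → ℝ≥0∞) : Prop where
  definite : ∀ f, AEMeasurable f P → N f = 0 → f =ᵐ[P] 0
  smul : ∀ (a : ℝ) f, AEMeasurable f P → N (a • f) = ‖a‖ₑ * N f
  triangle : ∀ f g, AEMeasurable f P → AEMeasurable g P → N (f + g) ≤ N f + N g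
  mono : ∀ f g, AEMeasurable f P → AEMeasurable g P → (∀ᵐ ω ∂P, |f ω| ≤ |g ω|) → N f ≤ N g
  complete : ∀ f : ℕ → Ω → ℝ, (∀ n, AEMeasurable (f n) P) → (∀ n, N (f n) < ∞) →
    (∀ ε : ℝ≥0∞, 0 < ε → ∃ K, ∀ m ≥ K, ∀ n ≥ K, N (f m - f n) < ε) →
    ∃ g, AEMeasurable g P ∧ Tendsto (fun n => N (f n - g)) atTop (𝓝 0)
  rearrangement_invariant : ∀ f g, IdentDistrib f g P P → N f = N g
  one_lt_top : N (fun _ => 1) < ∞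
  embeds_L1 : ∃ C : ℝ≥0, ∀ f, AEMeasurable f P → ∫⁻ ω, ‖f ω‖ₑ ∂P ≤ C * N f
  norming : ∀ f, AEMeasurable f P → N f < ∞ → N f = associate P (associate P N) f
  maximal_or_minimal :
    (∀ f, AEMeasurable f P → associate P (associate P N) f < ∞ → N f < ∞) ∨
    (∀ f, AEMeasurable f P → N f < ∞ → ∀ ε : ℝ≥0∞, 0 < ε → ∃ s : SimpleFunc Ω ℝ, N (f - s) < ε)

/-- The normed space `{f : N f < ∞}` is separable. -/
def IsSeparableNorm (P : Measure Ω) (N : (Ω → ℝ) → ℝ≥0∞) : Prop :=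
  ∃ D : Set (Ω → ℝ), D.Countable ∧ (∀ g ∈ D, AEMeasurable g P ∧ N g < ∞) ∧
    ∀ f, AEMeasurable f P → N f < ∞ → ∀ ε : ℝ≥0∞, 0 < ε → ∃ g ∈ D, N (f - g) < ε

/-! ### Domination constants

For each means of domination, the set of admissible finite constants; the best constant is the
infimum of this set, with value `∞` if there is no admissible finite constant. -/

/-- The constants `c` with `‖ξ‖_φ ≤ c ‖η‖_φ` for every Orlicz function `φ`. -/
def orliczConstants (P : Measure Ω) (ξ η : Ω → ℝ) : Set ℝ≥0 :=
  {c | ∀ φ, IsOrliczFunction φ → orliczNorm P φ ξ ≤ c * orliczNorm P φ η}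

/-- The constants `c` with `‖ξ‖_{φ_t} ≤ c ‖η‖_{φ_t}` for every `t > 0`. -/
def specialOrliczConstants (P : Measure Ω) (ξ η : Ω → ℝ) : Set ℝ≥0 :=
  {c | ∀ t : ℝ, 0 < t →
    orliczNorm P (specialOrlicz t) ξ ≤ c * orliczNorm P (specialOrlicz t) η}

/-- The constants `c` with `ξ** ≤ c η**`. -/
def maximalConstants (P : Measure Ω) (ξ η : Ω → ℝ) : Set ℝ≥0 :=
  {c | ∀ t : ℝ, 0 < t → maximalFunction P ξ t ≤ c * maximalFunction P η t}

/-- The constants `c` with `‖ξ‖ ≤ c ‖η‖` for every rearrangement invariant norm. -/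
def riConstants (P : Measure Ω) (ξ η : Ω → ℝ) : Set ℝ≥0 :=
  {c | ∀ N, IsRINorm P N → N ξ ≤ c * N η}

/-- The constants `c` with `‖ξ‖ ≤ c ‖η‖` for every separable rearrangement invariant norm. -/
def separableRIConstants (P : Measure Ω) (ξ η : Ω → ℝ) : Set ℝ≥0 :=
  {c | ∀ N, IsRINorm P N → IsSeparableNorm P N → N ξ ≤ c * N η}

/-- The best constant in `[0, ∞]` of a set of admissible finite constants. -/
def best (S : Set ℝ≥0) : ℝ≥0∞ := ⨅ c ∈ S, (c : ℝ≥0∞)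

end Domination

end

namespace Domination

variable {Ω : Type*} [MeasurableSpace Ω]

/-! All five conditions on a finite constant `c` are the same condition: with Z = cη, E(|ξ| - r)₊ ≤
E(|Z| - r)₊ for every r ≥ 0 (`WeaklyDominated`). So the five sets of constants coincide; the chain
in the theorem, factor 2 included, follows.

Three links carry this. For the special Orlicz functions, r is admissible for ‖f‖_{φ_t} exactly when
the excess of f at r is at most rt, so the norms for all t recover the excess function. For the
maximal function, t f**(t) is the minimum over r ≥ 0 of rt + E(|f| - r)₊, so comparing these
integrals and comparing excesses amount to the same thing. For general norms, the tool is a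
Hardy–Littlewood inequality (`WeaklyDominated.exists_lintegral_mul_le`): given g ≥ 0, the
rearrangement Y of |Z| that increases along g satisfies E|X|g ≤ E|Y|g. Against a subgradient it
gives E φ(|X|) ≤ E φ(|Z|); against the unit ball of the associate space it bounds the second
associate norm of X by the norm of Z.

Conversely, f ↦ ∫₀ᵗ f* for 0 < t ≤ 1 is itself a separable r.i. norm, equivalent to the `L¹` norm,
so testing only separable norms already yields weak domination. -/

section Coupling

/-! ### Quantiles and comonotone couplings -/

/-- The lower quantile function of a measure on the line. -/
noncomputable def quantile (m : Measure ℝ) (p : ℝ≥0∞) : ℝ := sInf {y | p ≤ m (Set.Iic y)}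

/-- The infimum is attained because y ↦ m(-∞, y] is right continuous; `h0` and `h1` make the set
bounded below and nonempty. -/
theorem quantile_le_iff {m : Measure ℝ} [IsFiniteMeasure m] {p : ℝ≥0∞} (h0 : 0 < p)
    (h1 : p < m Set.univ) (y : ℝ) : quantile m p ≤ y ↔ p ≤ m (Set.Iic y) := by
  have hne : {y | p ≤ m (Set.Iic y)}.Nonempty := by
    have := tendsto_measure_Iic_atTop m
    obtain ⟨y, hy⟩ := (this.eventually (lt_mem_nhds h1)).exists
    exact ⟨y, hy.le⟩
  have hbdd : BddBelow {y | p ≤ m (Set.Iic y)} := by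
    have := tendsto_measure_iInter_atBot (μ := m) (s := Set.Iic)
      (fun i : ℝ => measurableSet_Iic.nullMeasurableSet) (fun _ _ h => Set.Iic_subset_Iic.2 h)
      ⟨0, measure_ne_top _ _⟩
    rw [iInter_Iic_eq_empty_iff.2 (by simp [not_bddBelow_univ]), measure_empty] at this
    obtain ⟨y, hy⟩ := (this.eventually (gt_mem_nhds h0)).exists
    refine ⟨y, fun z hz => le_of_not_gt fun hzy => ?_⟩
    exact absurd (hz.trans (measure_mono (Set.Iic_subset_Iic.2 hzy.le))) hy.not_ge
  refine ⟨fun h => ?_, fun h => csInf_le hbdd h⟩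
  have key : p ≤ m (Set.Iic (quantile m p)) := by
    have hInt : Set.Iic (quantile m p) = ⋂ n : ℕ, Set.Iic (quantile m p + 1 / ((n : ℝ) + 1)) := by
      ext z
      simp only [Set.mem_Iic, Set.mem_iInter]
      refine ⟨fun hz n => hz.trans (by linarith [Nat.one_div_pos_of_nat (α := ℝ) (n := n)]),
        fun hz => le_of_forall_pos_le_add fun ε hε => ?_⟩
      obtain ⟨n, hn⟩ := exists_nat_one_div_lt hε
      linarith [hz n]
    have hT := tendsto_measure_iInter_atTop (μ := m)
      (s := fun n : ℕ => Set.Iic (quantile m p + 1 / ((n : ℝ) + 1)))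
      (fun n => measurableSet_Iic.nullMeasurableSet)
      (fun i j hij => Set.Iic_subset_Iic.2 (by
        have := Nat.one_div_le_one_div (α := ℝ) hij
        linarith)) ⟨0, measure_ne_top _ _⟩
    rw [← hInt] at hT
    refine ge_of_tendsto' hT fun n => ?_
    obtain ⟨z, hz, hzl⟩ := exists_lt_of_csInf_lt hne
      (lt_add_of_pos_right (quantile m p) (Nat.one_div_pos_of_nat (α := ℝ) (n := n)))
    exact hz.trans (measure_mono (Set.Iic_subset_Iic.2 hzl.le))
  exact key.trans (measure_mono (Set.Iic_subset_Iic.2 h))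

theorem le_measure_Iic_quantile {m : Measure ℝ} [IsFiniteMeasure m] {p : ℝ≥0∞} (h0 : 0 < p)
    (h1 : p < m Set.univ) : p ≤ m (Set.Iic (quantile m p)) :=
  (quantile_le_iff h0 h1 _).1 le_rfl

theorem measure_Iio_quantile_le {m : Measure ℝ} [IsFiniteMeasure m] {p : ℝ≥0∞} (h0 : 0 < p)
    (h1 : p < m Set.univ) : m (Set.Iio (quantile m p)) ≤ p := by
  have hU : Set.Iio (quantile m p) = ⋃ n : ℕ, Set.Iic (quantile m p - 1 / ((n : ℝ) + 1)) := by
    ext z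
    simp only [Set.mem_Iio, Set.mem_iUnion, Set.mem_Iic]
    refine ⟨fun hz => ?_, fun ⟨n, hn⟩ => hn.trans_lt (by
      linarith [Nat.one_div_pos_of_nat (α := ℝ) (n := n)])⟩
    obtain ⟨n, hn⟩ := exists_nat_one_div_lt (sub_pos.2 hz)
    exact ⟨n, by linarith⟩
  rw [hU, Monotone.measure_iUnion (fun i j hij => Set.Iic_subset_Iic.2 (by
        have := Nat.one_div_le_one_div (α := ℝ) hij
        linarith))]
  refine iSup_le fun n => le_of_not_gt fun h => ?_
  have := (quantile_le_iff h0 h1 _).2 h.le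
  linarith [Nat.one_div_pos_of_nat (α := ℝ) (n := n)]

/-- A variable uniform on [0, 1] has no atoms, which is what breaking ties requires. -/
theorem CarriesIndependentSequences.exists_uniform {P : Measure Ω}
    (hP : CarriesIndependentSequences P) :
    ∃ U : Ω → ℝ, Measurable U ∧ ∀ x, P {ω | U ω = x} = 0 := by
  have : IsProbabilityMeasure (volume.restrict (Set.Icc (0 : ℝ) 1)) := ⟨by simp⟩
  obtain ⟨X, hX, -, hmap⟩ := hP (fun _ => volume.restrict (Set.Icc (0 : ℝ) 1)) fun _ => this
  refine ⟨X 0, hX 0, fun x => ?_⟩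
  have := Measure.map_apply (μ := P) (hX 0) (measurableSet_singleton x)
  rw [hmap 0] at this
  rw [measure_singleton] at this
  exact this.symm

/-- The lexicographic order of the pairs `(g ω, U ω)`. -/
def LexLE (g U : Ω → ℝ) (ω' ω : Ω) : Prop := g ω' < g ω ∨ (g ω' = g ω ∧ U ω' ≤ U ω)

/-- Initial segments of the lexicographic order attain every mass: when g has an atom at its
p-quantile x, the atomless U cuts the level {g = x} at exactly the missing mass. -/
theorem exists_lexLE_lowerSet {P : Measure Ω} [IsProbabilityMeasure P] {g U : Ω → ℝ}
    (hg : Measurable g) (hU : Measurable U) (hU0 : ∀ x, P {ω | U ω = x} = 0) {p : ℝ≥0∞}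
    (h0 : 0 < p) (h1 : p < 1) :
    ∃ D : Set Ω, P D = p ∧ (∀ ω ∈ D, {ω' | LexLE g U ω' ω} ⊆ D) ∧
      ∀ ω ∉ D, D ⊆ {ω' | LexLE g U ω' ω} := by
  have : IsProbabilityMeasure (P.map g) := Measure.isProbabilityMeasure_map hg.aemeasurable
  have h1' : p < P.map g Set.univ := by simpa using h1
  set x := quantile (P.map g) p
  have hlo : P {ω | g ω < x} ≤ p := by
    have := measure_Iio_quantile_le h0 h1'
    rwa [Measure.map_apply hg measurableSet_Iio] at this
  have hhi : p ≤ P {ω | g ω ≤ x} := by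
    have := le_measure_Iic_quantile h0 h1'
    rwa [Measure.map_apply hg measurableSet_Iic] at this
  rcases hlo.eq_or_lt with heq | hlo
  · refine ⟨_, heq, fun ω hω ω' h => ?_, fun ω hω ω' h => ?_⟩ <;>
      simp only [Set.mem_ofPred_eq, LexLE] at * <;> grind
  rcases hhi.eq_or_lt with heq | hhi
  · refine ⟨_, heq.symm, fun ω hω ω' h => ?_, fun ω hω ω' h => ?_⟩ <;>
      simp only [Set.mem_ofPred_eq, LexLE] at * <;> grind
  have hE : MeasurableSet {ω | g ω = x} := hg (measurableSet_singleton x)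
  have hL : MeasurableSet {ω | g ω < x} := hg measurableSet_Iio
  set m : Measure ℝ := (P.restrict {ω | g ω = x}).map U
  have hm (s : Set ℝ) (hs : MeasurableSet s) : m s = P (U ⁻¹' s ∩ {ω | g ω = x}) := by
    rw [Measure.map_apply hU hs, Measure.restrict_apply (hU hs)]
  have hsplit : P {ω | g ω ≤ x} = P {ω | g ω < x} + P {ω | g ω = x} := by
    rw [← measure_union _ hE]
    · congr 1; ext ω; simp [le_iff_lt_or_eq]
    · rw [Set.disjoint_left]; intro ω h h'; simp at h h'; linarith
  set q := p - P {ω | g ω < x}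
  have hq : P {ω | g ω < x} + q = p := add_tsub_cancel_of_le hlo.le
  have hq0 : 0 < q := tsub_pos_of_lt hlo
  have hq1 : q < m Set.univ := by
    rw [hm _ MeasurableSet.univ, Set.preimage_univ, Set.univ_inter]
    rw [hsplit, ← hq] at hhi
    exact lt_of_add_lt_add_left hhi
  set u := quantile m q
  have hmu : m (Set.Iic u) = q := by
    refine le_antisymm ?_ (le_measure_Iic_quantile hq0 hq1)
    refine le_trans ?_ (measure_Iio_quantile_le hq0 hq1)
    rw [← Set.Iio_union_right]
    refine (measure_union_le _ _).trans ?_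
    have : m {u} = 0 := by
      rw [hm _ (measurableSet_singleton u)]
      exact measure_mono_null Set.inter_subset_left (hU0 u)
    rw [this, add_zero]
  refine ⟨{ω | g ω < x} ∪ (U ⁻¹' Set.Iic u ∩ {ω | g ω = x}), ?_, fun ω hω ω' h => ?_,
    fun ω hω ω' h => ?_⟩
  · rw [measure_union _ ((hU measurableSet_Iic).inter hE), ← hm _ measurableSet_Iic, hmu, hq]
    rw [Set.disjoint_left]; rintro ω h ⟨-, h'⟩; simp at h h'; linarith
  all_goals
    simp only [Set.mem_ofPred_eq, LexLE, Set.mem_union, Set.mem_inter_iff, Set.mem_preimage,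
      Set.mem_Iic] at *
    grind

/-- On a space carrying a continuous random variable, every random variable has a comonotone
companion with any prescribed law. -/
theorem CarriesIndependentSequences.exists_comonotone {P : Measure Ω} [IsProbabilityMeasure P]
    (hP : CarriesIndependentSequences P) {g : Ω → ℝ} (hg : Measurable g) (μ : Measure ℝ)
    [IsProbabilityMeasure μ] :
    ∃ Y : Ω → ℝ, Measurable Y ∧ P.map Y = μ ∧ ∃ S : Set Ω, (∀ᵐ ω ∂P, ω ∈ S) ∧
      ∀ ω ∈ S, ∀ ω' ∈ S, g ω < g ω' → Y ω ≤ Y ω' := by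
  obtain ⟨U, hU, hU0⟩ := hP.exists_uniform
  -- The lexicographic rank of ω: uniform on [0, 1] and nondecreasing along g. Composing it with the
  -- quantile function of μ gives the companion.
  set W : Ω → ℝ≥0∞ := fun ω => P {ω' | LexLE g U ω' ω} with hWdef
  have hWm : Measurable W := by
    have hs : MeasurableSet {z : Ω × Ω | LexLE g U z.2 z.1} := by
      refine (measurableSet_lt (hg.comp measurable_snd) (hg.comp measurable_fst)).union
        ((measurableSet_eq_fun (hg.comp measurable_snd) (hg.comp measurable_fst)).inter
        (measurableSet_le (hU.comp measurable_snd) (hU.comp measurable_fst)))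
    exact measurable_measure_prodMk_left hs
  have hWmono (ω ω' : Ω) (h : g ω < g ω') : W ω ≤ W ω' := by
    refine measure_mono fun z hz => ?_
    simp only [Set.mem_ofPred_eq, LexLE] at *
    grind
  have hW1 : ∀ ω, W ω ≤ 1 := fun ω => prob_le_one
  have hWp' {p : ℝ≥0∞} (h0 : 0 < p) (h1 : p < 1) : P {ω | W ω ≤ p} = p := by
    refine le_antisymm (le_of_forall_gt_imp_ge_of_dense fun r hr => ?_) ?_
    · rcases le_or_gt 1 r with h | h
      · exact prob_le_one.trans h
      obtain ⟨D, hD, -, hD'⟩ := exists_lexLE_lowerSet hg hU hU0 (h0.trans hr) h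
      rw [← hD]
      refine measure_mono fun ω hω => by_contra fun hωD => ?_
      have := measure_mono (μ := P) (hD' ω hωD)
      rw [hD] at this
      exact absurd (this.trans hω) hr.not_ge
    · obtain ⟨D, hD, hD', -⟩ := exists_lexLE_lowerSet hg hU hU0 h0 h1
      conv_lhs => rw [← hD]
      refine measure_mono fun ω hω => ?_
      exact (measure_mono (hD' ω hω)).trans hD.le
  have hWp {p : ℝ≥0∞} (h1 : p ≤ 1) : P {ω | W ω ≤ p} = p := by
    rcases h1.eq_or_lt with rfl | h1
    · simp [hW1]
    rcases eq_zero_or_pos p with rfl | h0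
    · refine le_antisymm (le_of_forall_gt_imp_ge_of_dense fun r hr => ?_) zero_le
      rcases le_or_gt 1 r with h | h
      · exact prob_le_one.trans h
      rw [← hWp' hr h]
      exact measure_mono fun ω hω => le_trans hω hr.le
    exact hWp' h0 h1
  have hS : ∀ᵐ ω ∂P, W ω ∈ Set.Ioo 0 1 := by
    have h0 : ∀ᵐ ω ∂P, ¬ W ω ≤ 0 := by rw [ae_iff]; simpa using hWp (p := 0) zero_le
    have h1 : ∀ᵐ ω ∂P, W ω < 1 := by
      refine (mem_ae_iff_prob_eq_one (hWm measurableSet_Iio)).2 ?_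
      refine le_antisymm prob_le_one (le_of_forall_lt_imp_le_of_dense fun r hr => ?_)
      rw [← hWp hr.le]
      exact measure_mono fun ω hω => lt_of_le_of_lt hω hr
    filter_upwards [h0, h1] with ω h0 h1 using ⟨not_le.1 h0, h1⟩
  classical
  set Y : Ω → ℝ := fun ω => if W ω ∈ Set.Ioo 0 1 then quantile μ (W ω) else 0 with hY
  have hYiff (ω) (hω : W ω ∈ Set.Ioo 0 1) (y : ℝ) : Y ω ≤ y ↔ W ω ≤ μ (Set.Iic y) := by
    rw [hY]
    simp only [hω, if_true]
    exact quantile_le_iff hω.1 (by simpa using hω.2) y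
  have hSm : MeasurableSet {ω | W ω ∈ Set.Ioo 0 1} := hWm measurableSet_Ioo
  have hYm : Measurable Y := by
    refine measurable_of_Iic fun y => ?_
    have : Y ⁻¹' Set.Iic y = ({ω | W ω ∈ Set.Ioo 0 1} ∩ {ω | W ω ≤ μ (Set.Iic y)}) ∪
        ({ω | W ω ∈ Set.Ioo 0 1}ᶜ ∩ {ω | 0 ≤ y}) := by
      ext ω
      by_cases h : W ω ∈ Set.Ioo 0 1
      · simpa only [Set.mem_preimage, Set.mem_Iic, Set.mem_union, Set.mem_inter_iff,
          Set.mem_ofPred_eq, h, Set.mem_compl_iff, not_true, false_and, or_false, true_and]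
          using hYiff ω h y
      · simp only [hY, Set.mem_preimage, Set.mem_Iic, Set.mem_union, Set.mem_inter_iff,
          Set.mem_ofPred_eq, h, if_false, Set.mem_compl_iff, not_false_eq_true, true_and,
          false_and, false_or]
    rw [this]
    exact (hSm.inter (hWm measurableSet_Iic)).union (hSm.compl.inter (MeasurableSet.const _))
  refine ⟨Y, hYm, ?_, {ω | W ω ∈ Set.Ioo 0 1}, hS, fun ω hω ω' hω' h => ?_⟩
  · have := Measure.isProbabilityMeasure_map (μ := P) hYm.aemeasurable
    refine Measure.ext_of_Iic _ _ fun y => ?_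
    rw [Measure.map_apply hYm measurableSet_Iic, ← hWp (p := μ (Set.Iic y)) prob_le_one]
    refine measure_congr ?_
    filter_upwards [hS] with ω hω
    exact propext (hYiff ω hω y)
  · rw [hYiff ω hω]
    exact (hWmono ω ω' h).trans ((hYiff ω' hω' _).1 le_rfl)

end Coupling

section WeakDomination

/-! ### Weak domination -/

/-- The expected excess `E (|f| - r)₊`. -/
noncomputable def excess (P : Measure Ω) (f : Ω → ℝ) (r : ℝ) : ℝ≥0∞ :=
  ∫⁻ ω, ENNReal.ofReal (|f ω| - r) ∂P

/-- The increasing convex order of `|f|` and `|g|`. -/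
def WeaklyDominated (P : Measure Ω) (f g : Ω → ℝ) : Prop :=
  ∀ r : ℝ, 0 ≤ r → excess P f r ≤ excess P g r

variable {P : Measure Ω} {f g X Y Z : Ω → ℝ}

theorem excess_mono_of_ae_le {r s : ℝ} (hrs : r ≤ s) (h : ∀ᵐ ω ∂P, |f ω| ≤ |g ω|) :
    excess P f s ≤ excess P g r :=
  lintegral_mono_ae (h.mono fun _ h => ENNReal.ofReal_le_ofReal (by linarith))

theorem excess_congr (h : f =ᵐ[P] g) (r : ℝ) : excess P f r = excess P g r :=
  lintegral_congr_ae (h.mono fun _ h => by simp only [h])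

theorem excess_zero_eq (f : Ω → ℝ) : excess P f 0 = ∫⁻ ω, ‖f ω‖ₑ ∂P := by
  simp [excess, Real.enorm_eq_ofReal_abs]

theorem excess_le_add [IsProbabilityMeasure P] (f : Ω → ℝ) (r s : ℝ) :
    excess P f r ≤ excess P f s + ENNReal.ofReal (s - r) := by
  calc excess P f r
      ≤ ∫⁻ ω, ENNReal.ofReal (|f ω| - s) + ENNReal.ofReal (s - r) ∂P :=
        lintegral_mono fun ω => by
          refine le_trans (ENNReal.ofReal_le_ofReal (le_of_eq ?_)) ENNReal.ofReal_add_le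
          ring
    _ = _ := by rw [lintegral_add_right _ measurable_const]; simp [excess]

theorem excess_smul {c : ℝ} (hc : 0 ≤ c) (f : Ω → ℝ) (r : ℝ) :
    excess P (c • f) (c * r) = ENNReal.ofReal c * excess P f r := by
  rw [excess, excess, ← lintegral_const_mul' _ _ ENNReal.ofReal_ne_top]
  refine lintegral_congr fun ω => ?_
  rw [← ENNReal.ofReal_mul hc, Pi.smul_apply, smul_eq_mul, abs_mul, abs_of_nonneg hc, mul_sub]

theorem WeaklyDominated.smul {c : ℝ} (hc : 0 < c) (h : WeaklyDominated P f g) :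
    WeaklyDominated P (c • f) (c • g) := fun r hr => by
  have := mul_le_mul_right (h (c⁻¹ * r) (by positivity)) (ENNReal.ofReal c)
  rwa [← excess_smul hc.le, ← excess_smul hc.le, mul_inv_cancel_left₀ hc.ne'] at this

theorem excess_eq_of_identDistrib (h : IdentDistrib f g P P) (r : ℝ) :
    excess P f r = excess P g r :=
  (h.comp (u := fun x => ENNReal.ofReal (|x| - r)) (by fun_prop)).lintegral_eq

/-- Integrate |X| ≤ r + (|X| - r)₊ over A. The next lemma is the reverse inequality when, up to null
sets, A lies between {|Y| > r} and {|Y| ≥ r}. -/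
theorem setLIntegral_enorm_le_mul_add_excess [IsFiniteMeasure P] (X : Ω → ℝ) (r : ℝ) (A : Set Ω) :
    ∫⁻ ω in A, ‖X ω‖ₑ ∂P ≤ ENNReal.ofReal r * P A + excess P X r := by
  calc ∫⁻ ω in A, ‖X ω‖ₑ ∂P
      ≤ ∫⁻ ω in A, ENNReal.ofReal r + ENNReal.ofReal (|X ω| - r) ∂P :=
        lintegral_mono fun ω => by
          rw [Real.enorm_eq_ofReal_abs]
          refine le_trans (ENNReal.ofReal_le_ofReal (le_of_eq ?_)) ENNReal.ofReal_add_le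
          ring
    _ = ENNReal.ofReal r * P A + ∫⁻ ω in A, ENNReal.ofReal (|X ω| - r) ∂P := by
        rw [lintegral_add_left measurable_const]; simp
    _ ≤ _ := by gcongr; exact setLIntegral_le_lintegral _ _

theorem mul_add_excess_le_setLIntegral [IsFiniteMeasure P] {r : ℝ} (hr : 0 ≤ r) {A : Set Ω}
    (hA : MeasurableSet A) (h1 : ∀ᵐ ω ∂P, ω ∈ A → r ≤ |Y ω|) (h2 : ∀ᵐ ω ∂P, ω ∉ A → |Y ω| ≤ r) :
    ENNReal.ofReal r * P A + excess P Y r ≤ ∫⁻ ω in A, ‖Y ω‖ₑ ∂P := by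
  have hc : ∫⁻ ω in Aᶜ, ENNReal.ofReal (|Y ω| - r) ∂P = 0 := by
    rw [setLIntegral_congr_fun_ae hA.compl (g := fun _ => 0)]
    · simp
    · filter_upwards [h2] with ω h hω
      exact ENNReal.ofReal_of_nonpos (by linarith [h hω])
  rw [excess, ← lintegral_add_compl _ hA, hc, add_zero]
  calc ENNReal.ofReal r * P A + ∫⁻ ω in A, ENNReal.ofReal (|Y ω| - r) ∂P
      = ∫⁻ ω in A, ENNReal.ofReal r + ENNReal.ofReal (|Y ω| - r) ∂P := by
        rw [lintegral_add_left measurable_const]; simp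
    _ ≤ _ := by
        refine setLIntegral_mono_ae' hA ?_
        filter_upwards [h1] with ω h hω
        rw [← ENNReal.ofReal_add hr (by linarith [h hω]), Real.enorm_eq_ofReal_abs]
        exact ENNReal.ofReal_le_ofReal (by linarith)

/-- A Hardy–Littlewood inequality: if `X` is weakly dominated by `Z` and `g ≥ 0`, then the
rearrangement `Y` of `|Z|` comonotone with `g` satisfies `E |X| g ≤ E |Y| g`. -/
theorem WeaklyDominated.exists_lintegral_mul_le [IsProbabilityMeasure P]
    (hP : CarriesIndependentSequences P) (hX : AEMeasurable X P) (hZ : AEMeasurable Z P)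
    (h : WeaklyDominated P X Z) (hg : Measurable g) (hg0 : ∀ ω, 0 ≤ g ω) :
    ∃ Y : Ω → ℝ, Measurable Y ∧ IdentDistrib Y (fun ω => |Z ω|) P P ∧
      ∫⁻ ω, ‖X ω‖ₑ * ENNReal.ofReal (g ω) ∂P ≤ ∫⁻ ω, ‖Y ω‖ₑ * ENNReal.ofReal (g ω) ∂P := by
  have hZ' : AEMeasurable (fun ω => |Z ω|) P := by fun_prop
  have := Measure.isProbabilityMeasure_map hZ'
  obtain ⟨Y, hY, hYZ, S, hS, hmono⟩ := hP.exists_comonotone hg (P.map fun ω => |Z ω|)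
  have hid : IdentDistrib Y (fun ω => |Z ω|) P P := ⟨hY.aemeasurable, hZ', hYZ⟩
  refine ⟨Y, hY, hid, ?_⟩
  have hY0 : ∀ᵐ ω ∂P, 0 ≤ Y ω :=
    hid.symm.ae_snd (p := fun x => 0 ≤ x) measurableSet_Ici (ae_of_all _ fun ω => abs_nonneg _)
  -- By the layer-cake formula for g it is enough to compare the integrals over each superlevel set.
  have hset (s : ℝ) : ∫⁻ ω in {ω | s < g ω}, ‖X ω‖ₑ ∂P ≤ ∫⁻ ω in {ω | s < g ω}, ‖Y ω‖ₑ ∂P := by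
    set A := {ω | s < g ω} with hA
    have hAm : MeasurableSet A := hg measurableSet_Ioi
    have hS' : ∀ᵐ ω ∂P, ω ∈ S ∧ 0 ≤ Y ω := hS.and hY0
    by_cases hne : ∃ a ∈ A, a ∈ S ∧ 0 ≤ Y a
    swap
    · have : P A = 0 := by
        rw [measure_eq_zero_iff_ae_notMem]
        filter_upwards [hS'] with ω hω hωA using hne ⟨ω, hωA, hω⟩
      rw [setLIntegral_measure_zero _ _ this]
      exact zero_le
    obtain ⟨a, haA, ha⟩ := hne
    -- By comonotonicity the supremum of the values of Y off A separates them from the values on A;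
    -- inserting 0 keeps this level nonnegative.
    set T : Set ℝ := insert 0 (Y '' {ω | ω ∉ A ∧ ω ∈ S ∧ 0 ≤ Y ω})
    have hub (ω) (hω : ω ∈ A) (hω' : ω ∈ S ∧ 0 ≤ Y ω) : Y ω ∈ upperBounds T := by
      rintro y (rfl | ⟨ω', ⟨h1, h2, h3⟩, rfl⟩)
      · exact hω'.2
      · exact hmono ω' h2 ω hω'.1 ((not_lt.1 h1).trans_lt hω)
    have hbdd : BddAbove T := ⟨_, hub a haA ha⟩
    have hr : 0 ≤ sSup T := le_csSup hbdd (Set.mem_insert _ _)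
    calc ∫⁻ ω in A, ‖X ω‖ₑ ∂P ≤ ENNReal.ofReal (sSup T) * P A + excess P X (sSup T) :=
          setLIntegral_enorm_le_mul_add_excess _ _ _
      _ ≤ ENNReal.ofReal (sSup T) * P A + excess P Z (sSup T) := by gcongr; exact h _ hr
      _ = ENNReal.ofReal (sSup T) * P A + excess P Y (sSup T) := by
          rw [excess_eq_of_identDistrib hid]; simp [excess]
      _ ≤ _ := by
          refine mul_add_excess_le_setLIntegral hr hAm ?_ ?_
          · filter_upwards [hS'] with ω hω hωA
            rw [abs_of_nonneg hω.2]
            exact csSup_le (Set.insert_nonempty _ _) (hub ω hωA hω)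
          · filter_upwards [hS'] with ω hω hωA
            rw [abs_of_nonneg hω.2]
            exact le_csSup hbdd (Set.mem_insert_of_mem _ ⟨ω, ⟨hωA, hω⟩, rfl⟩)
  have hlayer (V : Ω → ℝ) (hV : AEMeasurable V P) :
      ∫⁻ ω, ‖V ω‖ₑ * ENNReal.ofReal (g ω) ∂P =
        ∫⁻ s in Set.Ioi (0 : ℝ), ∫⁻ ω in {ω | s < g ω}, ‖V ω‖ₑ ∂P := by
    have h1 := lintegral_withDensity_eq_lintegral_mul₀ (μ := P) hV.enorm
      (g := fun ω => ENNReal.ofReal (g ω)) (by fun_prop)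
    simp only [Pi.mul_apply] at h1
    rw [← h1, lintegral_eq_lintegral_meas_lt _ (ae_of_all _ hg0) hg.aemeasurable]
    refine lintegral_congr fun s => withDensity_apply _ (hg measurableSet_Ioi)
  rw [hlayer X hX, hlayer Y hY.aemeasurable]
  exact lintegral_mono fun s => hset s

/-! ### Orlicz norms and weak domination -/

theorem IsOrliczFunction.exists_subgradient {φ : ℝ → ℝ} (hφ : IsOrliczFunction φ) :
    ∃ d : ℝ → ℝ, Monotone d ∧ (∀ x, 0 ≤ d x) ∧
      ∀ x y, 0 ≤ x → 0 ≤ y → φ x + d x * (y - x) ≤ φ y := by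
  -- Extended by its value at 0 to the negative half-line, φ stays convex and monotone, and the
  -- right derivative is a nonnegative subgradient even at 0.
  set ψ : ℝ → ℝ := fun x => φ (max x 0) with hψ
  have hψm : Monotone ψ := fun x y hxy =>
    hφ.monotoneOn (Set.mem_Ici.2 (le_max_right _ _)) (Set.mem_Ici.2 (le_max_right _ _))
      (max_le_max_right 0 hxy)
  have hψc : ConvexOn ℝ Set.univ ψ := by
    refine ⟨convex_univ, fun x _ y _ a b ha hb hab => ?_⟩
    refine le_trans (hφ.monotoneOn (Set.mem_Ici.2 (le_max_right _ _)) ?_ ?_)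
      (hφ.convexOn.2 (Set.mem_Ici.2 (le_max_right x 0)) (Set.mem_Ici.2 (le_max_right y 0))
        ha hb hab)
    · simp only [smul_eq_mul, Set.mem_Ici]; positivity
    · simp only [smul_eq_mul]
      refine max_le ?_ (by positivity)
      gcongr <;> exact le_max_left _ _
  have hint (x : ℝ) : x ∈ interior (Set.univ : Set ℝ) := by simp
  refine ⟨fun x => derivWithin ψ (Set.Ioi x) x, ?_, fun x => ?_, fun x y hx hy => ?_⟩
  · have := hψc.monotoneOn_rightDeriv
    rwa [interior_univ, monotoneOn_univ] at this
  · exact (hψm.monotoneOn _).derivWithin_nonneg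
  · have hx' : φ x = ψ x := by simp [hψ, hx]
    have hy' : φ y = ψ y := by simp [hψ, hy]
    rw [hx', hy']
    rcases lt_trichotomy x y with h | rfl | h
    · have := hψc.rightDeriv_le_slope_of_mem_interior (hint x) (Set.mem_univ y) h
      rw [slope_def_field, le_div_iff₀ (by linarith)] at this
      linarith
    · simp
    · have h1 := hψc.leftDeriv_le_rightDeriv_of_mem_interior (hint x)
      have h2 := hψc.slope_le_leftDeriv_of_mem_interior (Set.mem_univ y) (hint x) h
      have := h2.trans h1
      rw [slope_def_field, div_le_iff₀ (by linarith)] at this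
      linarith

theorem WeaklyDominated.congr_left (h : WeaklyDominated P X Z) (hXY : X =ᵐ[P] Y) :
    WeaklyDominated P Y Z := fun r hr => (excess_congr hXY r) ▸ h r hr

theorem WeaklyDominated.mono_left (h : WeaklyDominated P X Z) (hXY : ∀ᵐ ω ∂P, |Y ω| ≤ |X ω|) :
    WeaklyDominated P Y Z := fun r hr => (excess_mono_of_ae_le le_rfl hXY).trans (h r hr)

/-- Integrate the tangent inequality φ(V) + d(V)(Y - V) ≤ φ(Y), with V a truncation of |X| and Y the
rearrangement of |Z| comonotone with d(V): Hardy–Littlewood gives E V d(V) ≤ E Y d(V). Then remove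
the truncation by monotone convergence. -/
theorem WeaklyDominated.lintegral_orlicz_le [IsProbabilityMeasure P]
    (hP : CarriesIndependentSequences P) (hX : AEMeasurable X P) (hZ : AEMeasurable Z P)
    (h : WeaklyDominated P X Z) {φ : ℝ → ℝ} (hφ : IsOrliczFunction φ) :
    ∫⁻ ω, ENNReal.ofReal (φ |X ω|) ∂P ≤ ∫⁻ ω, ENNReal.ofReal (φ |Z ω|) ∂P := by
  wlog hXm : Measurable X generalizing X
  · have := this hX.measurable_mk.aemeasurable (h.congr_left hX.ae_eq_mk) hX.measurable_mk
    rwa [lintegral_congr_ae (g := fun ω => ENNReal.ofReal (φ |hX.mk X ω|))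
      (hX.ae_eq_mk.mono fun ω h => by simp only [← h])]
  obtain ⟨d, hdm, hd0, hd⟩ := hφ.exists_subgradient
  have hφm : Measurable fun x => φ |x| := by
    have h1 : Monotone fun x => φ (max x 0) := fun x y hxy =>
      hφ.monotoneOn (Set.mem_Ici.2 (le_max_right _ _)) (Set.mem_Ici.2 (le_max_right _ _))
      (max_le_max_right 0 hxy)
    have := h1.measurable.comp measurable_abs
    simpa [Function.comp_def] using this
  have hφ0 (x : ℝ) (hx : 0 ≤ x) : 0 ≤ φ x := by
    rw [← hφ.map_zero]; exact hφ.monotoneOn Set.self_mem_Ici hx hx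
  have htrunc (n : ℕ) : ∫⁻ ω, ENNReal.ofReal (φ (min |X ω| n)) ∂P ≤
      ∫⁻ ω, ENNReal.ofReal (φ |Z ω|) ∂P := by
    set V : Ω → ℝ := fun ω => min |X ω| n with hV
    have hVm : Measurable V := by fun_prop
    have hV0 : ∀ ω, 0 ≤ V ω := fun ω => le_min (abs_nonneg _) n.cast_nonneg
    have hVX : WeaklyDominated P V Z := h.mono_left (ae_of_all _ fun ω => by
      rw [abs_of_nonneg (hV0 ω)]; exact min_le_left _ _)
    have hgm : Measurable fun ω => d (V ω) := hdm.measurable.comp hVm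
    obtain ⟨Y, hY, hid, hle⟩ := hVX.exists_lintegral_mul_le hP hVm.aemeasurable hZ hgm
      fun ω => hd0 _
    have hfin : ∫⁻ ω, ‖V ω‖ₑ * ENNReal.ofReal (d (V ω)) ∂P ≠ ∞ := by
      refine ne_top_of_le_ne_top (b := ENNReal.ofReal n * ENNReal.ofReal (d n)) (by finiteness) ?_
      refine (lintegral_mono (g := fun _ => ENNReal.ofReal n * ENNReal.ofReal (d n))
        fun ω => ?_).trans (by simp)
      rw [Real.enorm_eq_ofReal_abs, abs_of_nonneg (hV0 ω)]
      have : V ω ≤ n := min_le_right _ _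
      exact mul_le_mul' (ENNReal.ofReal_le_ofReal this) (ENNReal.ofReal_le_ofReal (hdm this))
    have hYZ : ∫⁻ ω, ENNReal.ofReal (φ |Y ω|) ∂P = ∫⁻ ω, ENNReal.ofReal (φ |Z ω|) ∂P := by
      have := (hid.comp (u := fun x => ENNReal.ofReal (φ |x|)) hφm.ennreal_ofReal).lintegral_eq
      simpa [Function.comp_def] using this
    rw [← hYZ]
    -- Truncation makes E V d(V) finite, so this term may be added to both sides and cancelled,
    -- avoiding subtraction in `ℝ≥0∞`.
    refine ENNReal.le_of_add_le_add_right hfin ?_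
    calc ∫⁻ ω, ENNReal.ofReal (φ (V ω)) ∂P + ∫⁻ ω, ‖V ω‖ₑ * ENNReal.ofReal (d (V ω)) ∂P
        ≤ ∫⁻ ω, ENNReal.ofReal (φ (V ω)) ∂P + ∫⁻ ω, ‖Y ω‖ₑ * ENNReal.ofReal (d (V ω)) ∂P := by
          gcongr
      _ ≤ ∫⁻ ω, ENNReal.ofReal (φ (V ω)) + ‖Y ω‖ₑ * ENNReal.ofReal (d (V ω)) ∂P :=
          le_lintegral_add _ _
      _ ≤ ∫⁻ ω, ENNReal.ofReal (φ |Y ω|) + ‖V ω‖ₑ * ENNReal.ofReal (d (V ω)) ∂P := by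
          refine lintegral_mono fun ω => ?_
          have := hd (V ω) |Y ω| (hV0 ω) (abs_nonneg _)
          simp only [Real.enorm_eq_ofReal_abs, abs_of_nonneg (hV0 ω)]
          rw [← ENNReal.ofReal_mul (abs_nonneg _), ← ENNReal.ofReal_mul (hV0 ω),
            ← ENNReal.ofReal_add (hφ0 _ (hV0 ω)) (mul_nonneg (abs_nonneg _) (hd0 _)),
            ← ENNReal.ofReal_add (hφ0 _ (abs_nonneg _)) (mul_nonneg (hV0 ω) (hd0 _))]
          exact ENNReal.ofReal_le_ofReal (by linarith)
      _ = _ := lintegral_add_left (hφm.comp hY).ennreal_ofReal _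
  have hmono : ∀ ω, Monotone fun n : ℕ => ENNReal.ofReal (φ (min |X ω| n)) := fun ω m n hmn => by
    refine ENNReal.ofReal_le_ofReal (hφ.monotoneOn ?_ ?_ ?_)
    · exact Set.mem_Ici.2 <| le_min (abs_nonneg _) m.cast_nonneg
    · exact Set.mem_Ici.2 <| le_min (abs_nonneg _) n.cast_nonneg
    · exact min_le_min_left _ (by exact_mod_cast hmn)
  have hlim : ∀ ω, Tendsto (fun n : ℕ => ENNReal.ofReal (φ (min |X ω| n))) atTop
      (𝓝 (ENNReal.ofReal (φ |X ω|))) := fun ω => by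
    obtain ⟨N, hN⟩ := exists_nat_ge |X ω|
    refine tendsto_const_nhds.congr' ?_
    filter_upwards [eventually_ge_atTop N] with n hn
    rw [min_eq_left (hN.trans (by exact_mod_cast hn))]
  have hmeas (n : ℕ) : AEMeasurable (fun ω => ENNReal.ofReal (φ (min |X ω| n))) P := by
    have : Measurable fun ω => φ |min |X ω| n| := hφm.comp (by fun_prop)
    refine (Measurable.ennreal_ofReal ?_).aemeasurable
    simpa only [abs_of_nonneg (le_min (abs_nonneg _) n.cast_nonneg : (0 : ℝ) ≤ min |X _| n)]
      using this
  exact le_of_tendsto' (lintegral_tendsto_of_tendsto_of_monotone hmeas (ae_of_all _ hmono)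
    (ae_of_all _ hlim)) htrunc

theorem WeaklyDominated.orliczNorm_le [IsProbabilityMeasure P]
    (hP : CarriesIndependentSequences P) (hX : AEMeasurable X P) (hZ : AEMeasurable Z P)
    (h : WeaklyDominated P X Z) {φ : ℝ → ℝ} (hφ : IsOrliczFunction φ) :
    orliczNorm P φ X ≤ orliczNorm P φ Z := by
  refine le_iInf fun r => le_iInf fun hr => le_iInf fun hZ1 => ?_
  refine iInf_le_of_le r (iInf_le_of_le hr (iInf_le_of_le ?_ le_rfl))
  have := (h.smul (inv_pos.2 hr)).lintegral_orlicz_le hP (hX.const_smul _) (hZ.const_smul _) hφ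
  refine le_trans ?_ (this.trans (le_trans ?_ hZ1)) <;>
  · simp [abs_mul, abs_of_pos hr, div_eq_inv_mul]

/-! ### Homogeneity of Orlicz norms and the special Orlicz functions -/

theorem orliczNorm_smul_le (P : Measure Ω) (φ : ℝ → ℝ) (f : Ω → ℝ) {c : ℝ} (hc : 0 < c) :
    orliczNorm P φ (c • f) ≤ ENNReal.ofReal c * orliczNorm P φ f := by
  have hc0 : ENNReal.ofReal c ≠ 0 := by simpa using hc
  rw [mul_comm, ← ENNReal.div_le_iff_le_mul (Or.inl hc0) (Or.inl ENNReal.ofReal_ne_top)]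
  refine le_iInf fun r => le_iInf fun hr => le_iInf fun h1 => ?_
  rw [ENNReal.div_le_iff_le_mul (Or.inl hc0) (Or.inl ENNReal.ofReal_ne_top)]
  refine iInf_le_of_le (r * c) (iInf_le_of_le (by positivity) (iInf_le_of_le ?_
    (ENNReal.ofReal_mul hr.le).le))
  convert! h1 using 5 with ω
  rw [Pi.smul_apply, smul_eq_mul, abs_mul, abs_of_pos hc, mul_comm, mul_div_mul_right _ _ hc.ne']

theorem orliczNorm_zero [IsFiniteMeasure P] {φ : ℝ → ℝ} (hφ : φ 0 = 0) :
    orliczNorm P φ 0 = 0 := by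
  refine le_antisymm (ENNReal.le_of_forall_pos_le_add fun ε hε _ => ?_) zero_le
  refine iInf_le_of_le ε (iInf_le_of_le (by exact_mod_cast hε) (iInf_le_of_le ?_ (by simp)))
  simp [hφ]

theorem orliczNorm_smul [IsFiniteMeasure P] {φ : ℝ → ℝ} (hφ : φ 0 = 0) (f : Ω → ℝ) (c : ℝ≥0) :
    orliczNorm P φ ((c : ℝ) • f) = c * orliczNorm P φ f := by
  -- At c = 0 the identity relies on 0 · ∞ = 0.
  rcases eq_zero_or_pos c with rfl | hc
  · simp [orliczNorm_zero hφ]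
  have hc' : (0 : ℝ) < c := hc
  refine le_antisymm (by simpa using orliczNorm_smul_le P φ f hc') ?_
  have := orliczNorm_smul_le P φ ((c : ℝ) • f) (inv_pos.2 hc')
  rw [inv_smul_smul₀ hc'.ne', ENNReal.ofReal_inv_of_pos hc', ENNReal.ofReal_coe_nnreal] at this
  rwa [mul_comm, ← ENNReal.le_div_iff_mul_le (by simp [hc.ne']) (by simp), ENNReal.div_eq_inv_mul]

theorem isOrliczFunction_specialOrlicz {t : ℝ} (ht : 0 < t) :
    IsOrliczFunction (specialOrlicz t) where
  map_zero := by simp [specialOrlicz]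
  continuousOn := by unfold specialOrlicz; fun_prop
  monotoneOn := fun x _ y _ h => by unfold specialOrlicz; gcongr
  convexOn := by
    have h1 : ConvexOn ℝ (Set.Ici (0 : ℝ)) fun x : ℝ => max (x - 1) 0 :=
      ((convexOn_id (convex_Ici 0)).sub (concaveOn_const 1 (convex_Ici 0))).sup
        (convexOn_const 0 (convex_Ici 0))
    have := h1.smul (inv_nonneg.2 ht.le)
    refine this.congr fun x _ => ?_
    simp [specialOrlicz, div_eq_inv_mul]
  tendsto_atTop := by
    refine Tendsto.atTop_div_const ht (tendsto_atTop_mono (fun x => le_max_left (x - 1) 0) ?_)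
    exact tendsto_atTop_add_const_right _ _ tendsto_id

theorem lintegral_specialOrlicz_le_one_iff {t r : ℝ} (ht : 0 < t) (hr : 0 < r) (f : Ω → ℝ) :
    ∫⁻ ω, ENNReal.ofReal (specialOrlicz t (|f ω| / r)) ∂P ≤ 1 ↔
      excess P f r ≤ ENNReal.ofReal (r * t) := by
  have hrt : 0 < r * t := by positivity
  have : ∫⁻ ω, ENNReal.ofReal (specialOrlicz t (|f ω| / r)) ∂P =
      excess P f r / ENNReal.ofReal (r * t) := by
    rw [excess, div_eq_mul_inv, ← lintegral_mul_const' _ _ (by simpa using hrt)]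
    refine lintegral_congr fun ω => ?_
    have h0 : ENNReal.ofReal (|f ω| - r) = ENNReal.ofReal (max (|f ω| - r) 0) := by
      rcases le_total (|f ω| - r) 0 with h | h <;> simp [h, ENNReal.ofReal_of_nonpos]
    rw [← div_eq_mul_inv, h0, ← ENNReal.ofReal_div_of_pos hrt, specialOrlicz, div_mul_eq_div_div,
      ← max_div_div_right hr.le, sub_div, div_self hr.ne', zero_div]
  rw [this, ENNReal.div_le_iff_le_mul (by simp [hrt]) (by simp), one_mul]

/-- Take t so that the excess of Z at r is rt. Then the φ_t-norm of Z, hence that of X, is at most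
r, so the excess of X at r is at most rt. -/
theorem weaklyDominated_of_specialOrlicz_le [IsProbabilityMeasure P]
    (h : ∀ t : ℝ, 0 < t → orliczNorm P (specialOrlicz t) X ≤ orliczNorm P (specialOrlicz t) Z) :
    WeaklyDominated P X Z := by
  have main (r : ℝ) (hr : 0 < r) : excess P X r ≤ excess P Z r := by
    rcases eq_or_ne (excess P Z r) ∞ with htop | htop
    · rw [htop]; exact le_top
    set e := (excess P Z r).toReal
    have he : ENNReal.ofReal e = excess P Z r := ENNReal.ofReal_toReal htop
    have he0 : 0 ≤ e := ENNReal.toReal_nonneg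
    -- The slack δ keeps t positive when the excess of Z vanishes, and yields an admissible radius
    -- r' < r + δ without the infimum being attained.
    have key (δ : ℝ) (hδ : 0 < δ) :
        excess P X r ≤ ENNReal.ofReal ((r + δ) * ((e + δ) / r) + δ) := by
      set t := (e + δ) / r
      have ht : 0 < t := by positivity
      have h1 : orliczNorm P (specialOrlicz t) Z ≤ ENNReal.ofReal r := by
        refine iInf_le_of_le r (iInf_le_of_le hr (iInf_le_of_le ?_ le_rfl))
        rw [lintegral_specialOrlicz_le_one_iff ht hr, ← he]
        refine ENNReal.ofReal_le_ofReal ?_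
        rw [mul_div_cancel₀ _ hr.ne']
        linarith
      have h2 : orliczNorm P (specialOrlicz t) X < ENNReal.ofReal (r + δ) :=
        ((h t ht).trans h1).trans_lt ((ENNReal.ofReal_lt_ofReal_iff (by linarith)).2 (by linarith))
      simp only [orliczNorm, iInf_lt_iff] at h2
      obtain ⟨r', hr', h3, h4⟩ := h2
      rw [lintegral_specialOrlicz_le_one_iff ht hr'] at h3
      have h5 : r' < r + δ := (ENNReal.ofReal_lt_ofReal_iff (by linarith)).1 h4
      calc excess P X r ≤ excess P X (r + δ) + ENNReal.ofReal (r + δ - r) := excess_le_add _ _ _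
        _ ≤ excess P X r' + ENNReal.ofReal (r + δ - r) := by
            gcongr; exact excess_mono_of_ae_le h5.le (ae_of_all _ fun _ => le_rfl)
        _ ≤ ENNReal.ofReal ((r + δ) * t) + ENNReal.ofReal δ := by
            rw [add_sub_cancel_left]
            gcongr
            exact h3.trans (ENNReal.ofReal_le_ofReal (by gcongr))
        _ = _ := (ENNReal.ofReal_add (by positivity) hδ.le).symm
    have hlim : Tendsto (fun δ : ℝ => ENNReal.ofReal ((r + δ) * ((e + δ) / r) + δ)) (𝓝[>] 0)
        (𝓝 (ENNReal.ofReal ((r + 0) * ((e + 0) / r) + 0))) :=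
      ((ENNReal.continuous_ofReal.comp (by fun_prop)).tendsto 0).mono_left nhdsWithin_le_nhds
    have := ge_of_tendsto hlim (eventually_mem_nhdsWithin.mono fun δ hδ => key δ hδ)
    rwa [add_zero, add_zero, add_zero, mul_div_cancel₀ _ hr.ne', he] at this
  intro r hr
  have hlim : Tendsto (fun δ : ℝ => excess P Z r + ENNReal.ofReal δ) (𝓝[>] 0)
      (𝓝 (excess P Z r + ENNReal.ofReal 0)) :=
    (tendsto_const_nhds.add (ENNReal.continuous_ofReal.tendsto 0)).mono_left nhdsWithin_le_nhds
  rw [ENNReal.ofReal_zero, add_zero] at hlim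
  refine ge_of_tendsto hlim (eventually_mem_nhdsWithin.mono fun δ (hδ : 0 < δ) => ?_)
  calc excess P X r ≤ excess P X (r + δ) + ENNReal.ofReal (r + δ - r) := excess_le_add _ _ _
    _ ≤ excess P Z (r + δ) + ENNReal.ofReal (r + δ - r) := by
        gcongr; exact main _ (by linarith)
    _ ≤ excess P Z r + ENNReal.ofReal δ := by
        rw [add_sub_cancel_left]
        gcongr
        exact excess_mono_of_ae_le (by linarith) (ae_of_all _ fun _ => le_rfl)

end WeakDomination

section RearrangementIntegral

/-! ### The integrated rearrangement -/

/-- The integral `∫₀ᵗ f*(u) du`. -/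
noncomputable def rearrangementIntegral (P : Measure Ω) (f : Ω → ℝ) (t : ℝ) : ℝ≥0∞ :=
  ∫⁻ u in Set.Ioc 0 t, rearrangement P f u

variable {P : Measure Ω} {f g X Z : Ω → ℝ}

/-! ### Layer-cake formulas and the duality between ∫₀ᵗ f* and the excess -/

theorem measure_mono_of_imp (P : Measure Ω) {p q : Ω → Prop} (h : ∀ ω, p ω → q ω) :
    P {ω | p ω} ≤ P {ω | q ω} := measure_mono h

/-- T lies between (0, R) and (0, R]. This absorbs the difference between strict and weak
inequalities in what follows. -/
theorem volume_eq_of_initial {T : Set ℝ} {R : ℝ≥0∞} (hT : T ⊆ Set.Ioi 0)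
    (h1 : ∀ s ∈ T, ENNReal.ofReal s ≤ R) (h2 : ∀ s, 0 < s → ENNReal.ofReal s < R → s ∈ T) :
    volume T = R := by
  rcases eq_or_ne R ∞ with rfl | hR
  · have : T = Set.Ioi 0 := hT.antisymm fun s hs => h2 s hs ENNReal.ofReal_lt_top
    rw [this, Real.volume_Ioi]
  refine le_antisymm ?_ ?_
  · have : T ⊆ Set.Ioc 0 R.toReal := fun s hs =>
      ⟨hT hs, (ENNReal.ofReal_le_iff_le_toReal hR).1 (h1 s hs)⟩
    refine (measure_mono this).trans ?_
    rw [Real.volume_Ioc, sub_zero, ENNReal.ofReal_toReal hR]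
  · have : Set.Ioo 0 R.toReal ⊆ T := fun s hs =>
      h2 s hs.1 ((ENNReal.ofReal_lt_iff_lt_toReal hs.1.le hR).2 hs.2)
    refine le_trans ?_ (measure_mono this)
    rw [Real.volume_Ioo, sub_zero, ENNReal.ofReal_toReal hR]

theorem rearrangement_eq_volume (P : Measure Ω) (f : Ω → ℝ) (u : ℝ) :
    rearrangement P f u = volume {s : ℝ | 0 < s ∧ ENNReal.ofReal u < P {ω | s < |f ω|}} := by
  symm
  refine volume_eq_of_initial (fun s hs => hs.1) (fun s hs => ?_) fun s hs h => ⟨hs, ?_⟩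
  · lift s to ℝ≥0 using hs.1.le
    refine le_iSup₂_of_le s ?_ (by simp)
    exact hs.2.trans_le (measure_mono_of_imp P fun ω hω => hω.le)
  · simp only [rearrangement, lt_iSup_iff] at h
    obtain ⟨s', hs', h⟩ := h
    refine hs'.trans_le (measure_mono_of_imp P fun ω hω => lt_of_lt_of_le ?_ hω)
    rwa [← ENNReal.ofReal_coe_nnreal, ENNReal.ofReal_lt_ofReal_iff_of_nonneg hs.le] at h

/-- Tonelli on the region u < P(|f| > s), with 0 < u ≤ t and s > 0, sliced in either direction. -/
theorem rearrangementIntegral_eq (P : Measure Ω) (f : Ω → ℝ) (t : ℝ) :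
    rearrangementIntegral P f t =
      ∫⁻ s in Set.Ioi (0 : ℝ), min (ENNReal.ofReal t) (P {ω | s < |f ω|}) := by
  have hp : Measurable fun s : ℝ => P {ω | s < |f ω|} :=
    Antitone.measurable fun s s' h => measure_mono fun ω hω => lt_of_le_of_lt h hω
  have hm : MeasurableSet {z : ℝ × ℝ | ENNReal.ofReal z.1 < P {ω | z.2 < |f ω|}} :=
    measurableSet_lt (by fun_prop) (hp.comp measurable_snd)
  set F : ℝ → ℝ → ℝ≥0∞ := fun u s =>
    {z : ℝ × ℝ | ENNReal.ofReal z.1 < P {ω | z.2 < |f ω|}}.indicator 1 (u, s)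
  have h1 (u : ℝ) : rearrangement P f u = ∫⁻ s in Set.Ioi (0 : ℝ), F u s := by
    have : (fun s => F u s) = {s : ℝ | ENNReal.ofReal u < P {ω | s < |f ω|}}.indicator 1 := rfl
    have hms : MeasurableSet {s : ℝ | ENNReal.ofReal u < P {ω | s < |f ω|}} :=
      measurableSet_lt measurable_const hp
    rw [this, lintegral_indicator_one hms, Measure.restrict_apply hms, rearrangement_eq_volume]
    congr 1
    ext s
    exact and_comm
  have h2 (s : ℝ) : ∫⁻ u in Set.Ioc 0 t, F u s = min (ENNReal.ofReal t) (P {ω | s < |f ω|}) := by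
    have : (fun u => F u s) = {u : ℝ | ENNReal.ofReal u < P {ω | s < |f ω|}}.indicator 1 := rfl
    have hms : MeasurableSet {u : ℝ | ENNReal.ofReal u < P {ω | s < |f ω|}} :=
      measurableSet_lt (by fun_prop) measurable_const
    rw [this, lintegral_indicator_one hms, Measure.restrict_apply hms]
    refine volume_eq_of_initial (fun u hu => hu.2.1) (fun u hu => ?_) fun u hu h => ?_
    · exact le_min (ENNReal.ofReal_le_ofReal hu.2.2) (le_of_lt hu.1)
    · rw [lt_min_iff, ENNReal.ofReal_lt_ofReal_iff_of_nonneg hu.le] at h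
      exact ⟨h.2, hu, h.1.le⟩
  rw [rearrangementIntegral]
  simp_rw [h1, ← h2]
  exact lintegral_lintegral_swap (measurable_one.indicator hm).aemeasurable

theorem excess_eq_lintegral (hf : AEMeasurable f P) (r : ℝ) :
    excess P f r = ∫⁻ s in Set.Ioi r, P {ω | s < |f ω|} := by
  have h0 : excess P f r = ∫⁻ ω, ENNReal.ofReal (max (|f ω| - r) 0) ∂P :=
    lintegral_congr fun ω => by
      rcases le_total (|f ω| - r) 0 with h | h <;> simp [h, ENNReal.ofReal_of_nonpos]
  have h1 := (measurePreserving_add_right (volume : Measure ℝ) r).setLIntegral_comp_preimage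
    (measurableSet_Ioi (a := r)) (f := fun s => P {ω | s < |f ω|})
    (Antitone.measurable fun s s' h => measure_mono fun ω hω => lt_of_le_of_lt h hω)
  rw [h0, lintegral_eq_lintegral_meas_lt (f := fun ω => max (|f ω| - r) 0) _
      (ae_of_all _ fun ω => le_max_right _ _) (by fun_prop),
    ← h1]
  have : (fun x => x + r) ⁻¹' Set.Ioi r = Set.Ioi 0 := by ext; simp
  rw [this]
  refine setLIntegral_congr_fun measurableSet_Ioi fun s (hs : 0 < s) => ?_
  simp only [lt_max_iff, hs.not_gt, or_false, lt_sub_iff_add_lt]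

theorem rearrangementIntegral_le (hf : AEMeasurable f P) {r : ℝ} (hr : 0 ≤ r) (t : ℝ) :
    rearrangementIntegral P f t ≤ ENNReal.ofReal r * ENNReal.ofReal t + excess P f r := by
  rw [rearrangementIntegral_eq, excess_eq_lintegral hf, ← Set.Ioc_union_Ioi_eq_Ioi hr]
  refine (lintegral_union_le _ _ _).trans (add_le_add ?_ (lintegral_mono fun s => min_le_right _ _))
  refine (lintegral_mono fun s => min_le_left _ _).trans ?_
  rw [setLIntegral_const, Real.volume_Ioc, sub_zero, mul_comm]

/-- At an upper t-quantile r, min(t, P(|f| > s)) equals t for s < r and the probability for s > r,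
so the previous bound is sharp. -/
theorem rearrangementIntegral_eq_add_excess (hf : AEMeasurable f P) {r t : ℝ} (hr : 0 ≤ r)
    (h1 : P {ω | r < |f ω|} ≤ ENNReal.ofReal t)
    (h2 : r = 0 ∨ ENNReal.ofReal t ≤ P {ω | r ≤ |f ω|}) :
    rearrangementIntegral P f t = ENNReal.ofReal r * ENNReal.ofReal t + excess P f r := by
  refine le_antisymm (rearrangementIntegral_le hf hr t) ?_
  have hsub : Set.Ioo 0 r ∪ Set.Ioi r ⊆ Set.Ioi 0 :=
    Set.union_subset (fun s hs => hs.1) fun s hs => lt_of_le_of_lt hr hs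
  have hdisj : Disjoint (Set.Ioo 0 r) (Set.Ioi r) :=
    Set.disjoint_left.2 fun s hs hs' => lt_asymm hs.2 hs'
  rw [rearrangementIntegral_eq, excess_eq_lintegral hf]
  refine le_trans ?_ (lintegral_mono_set hsub)
  rw [lintegral_union measurableSet_Ioi hdisj]
  refine add_le_add ?_ ?_
  · have : ENNReal.ofReal r * ENNReal.ofReal t = ∫⁻ s in Set.Ioo 0 r, ENNReal.ofReal t := by
      rw [setLIntegral_const, Real.volume_Ioo, sub_zero, mul_comm]
    rw [this]
    refine setLIntegral_mono' measurableSet_Ioo fun s hs => le_min le_rfl ?_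
    refine (h2.resolve_left (hs.1.trans hs.2).ne').trans (measure_mono fun ω hω => ?_)
    exact lt_of_lt_of_le hs.2 hω
  · refine setLIntegral_mono' measurableSet_Ioi fun s hs => le_min ?_ le_rfl
    exact (measure_mono_of_imp P fun ω hω => lt_trans hs hω).trans h1

theorem exists_upper_quantile [IsProbabilityMeasure P] (hf : AEMeasurable f P) {t : ℝ}
    (ht : 0 < t) : ∃ r : ℝ, 0 ≤ r ∧ P {ω | r < |f ω|} ≤ ENNReal.ofReal t ∧
      (r = 0 ∨ ENNReal.ofReal t ≤ P {ω | r ≤ |f ω|}) := by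
  rcases le_or_gt 1 t with h | h
  · exact ⟨0, le_rfl, prob_le_one.trans (by simpa using h), Or.inl rfl⟩
  have hf' : AEMeasurable (fun ω => |f ω|) P := by fun_prop
  set m := P.map fun ω => |f ω|
  have : IsProbabilityMeasure m := Measure.isProbabilityMeasure_map hf'
  have hm (s : Set ℝ) (hs : MeasurableSet s) : m s = P {ω | |f ω| ∈ s} :=
    Measure.map_apply_of_aemeasurable hf' hs
  have ht1 : ENNReal.ofReal t < 1 := by simpa using h
  -- The upper t-quantile is the lower quantile of order 1 - t of the law of |f|.
  have h0 : 0 < 1 - ENNReal.ofReal t := tsub_pos_of_lt ht1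
  have h1 : 1 - ENNReal.ofReal t < m Set.univ := by
    rw [measure_univ]
    exact ENNReal.sub_lt_self (by simp) (by simp) (by simpa using ht)
  have hq1 := measure_Iio_quantile_le h0 h1
  have hq2 := le_measure_Iic_quantile h0 h1
  set r := quantile m (1 - ENNReal.ofReal t)
  refine ⟨r, ?_, ?_, Or.inr ?_⟩
  · by_contra! hr
    have : m (Set.Iic r) = 0 := by
      rw [hm _ measurableSet_Iic]
      convert! measure_empty (μ := P)
      ext ω
      simpa using hr.trans_le (abs_nonneg _)
    exact absurd (h0.trans_le hq2) (by simp [this])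
  · have : m (Set.Iic r)ᶜ = 1 - m (Set.Iic r) := prob_compl_eq_one_sub measurableSet_Iic
    rw [Set.compl_Iic, hm _ measurableSet_Ioi] at this
    refine this.le.trans ?_
    rw [tsub_le_iff_right, ← tsub_le_iff_left]
    exact hq2
  · have : m (Set.Iio r)ᶜ = 1 - m (Set.Iio r) := prob_compl_eq_one_sub measurableSet_Iio
    rw [Set.compl_Iio, hm _ measurableSet_Ici] at this
    refine le_trans ?_ this.ge
    refine ENNReal.le_sub_of_add_le_left (measure_ne_top _ _) ?_
    calc m (Set.Iio r) + ENNReal.ofReal t ≤ (1 - ENNReal.ofReal t) + ENNReal.ofReal t := by gcongr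
      _ = 1 := tsub_add_cancel_of_le ht1.le

/-- Both directions play the bound for all r against equality at a quantile: forwards r is the
t-quantile of Z, backwards t = P(|X| > r). -/
theorem weaklyDominated_iff_rearrangementIntegral_le [IsProbabilityMeasure P]
    (hX : AEMeasurable X P) (hZ : AEMeasurable Z P) :
    WeaklyDominated P X Z ↔
      ∀ t : ℝ, 0 < t → rearrangementIntegral P X t ≤ rearrangementIntegral P Z t := by
  refine ⟨fun h t ht => ?_, fun h r hr => ?_⟩
  · obtain ⟨r, hr, h1, h2⟩ := exists_upper_quantile hZ ht
    rw [rearrangementIntegral_eq_add_excess hZ hr h1 h2]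
    exact (rearrangementIntegral_le hX hr t).trans (by gcongr; exact h r hr)
  · rcases eq_zero_or_pos (P {ω | r < |X ω|}) with h0 | h0
    · have : excess P X r = 0 := by
        rw [excess_eq_lintegral hX]
        refine (setLIntegral_congr_fun measurableSet_Ioi (g := fun _ => 0) fun s hs => ?_).trans
          (by simp)
        exact nonpos_iff_eq_zero.1 ((measure_mono_of_imp P fun ω hω => lt_trans hs hω).trans h0.le)
      rw [this]
      exact zero_le
    · set t := (P {ω | r < |X ω|}).toReal
      have ht : ENNReal.ofReal t = P {ω | r < |X ω|} := ENNReal.ofReal_toReal (measure_ne_top _ _)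
      have ht0 : 0 < t := by rwa [← ht, ENNReal.ofReal_pos] at h0
      have hX' := rearrangementIntegral_eq_add_excess hX hr ht.ge
        (Or.inr (ht.le.trans (measure_mono_of_imp P fun ω hω => hω.le)))
      have := (hX'.symm.le.trans (h t ht0)).trans (rearrangementIntegral_le hZ hr t)
      exact (ENNReal.add_le_add_iff_left (by finiteness)).1 this

/-! ### The integrated rearrangement is a separable rearrangement invariant norm -/

/-! ### Norm properties, and equivalence with the `L¹` norm for 0 < t ≤ 1 -/

theorem rearrangementIntegral_le_lintegral (hf : AEMeasurable f P) (t : ℝ) :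
    rearrangementIntegral P f t ≤ ∫⁻ ω, ‖f ω‖ₑ ∂P := by
  simpa [excess_zero_eq] using rearrangementIntegral_le hf le_rfl t

theorem mul_lintegral_le_rearrangementIntegral [IsProbabilityMeasure P] (hf : AEMeasurable f P)
    {t : ℝ} (ht1 : t ≤ 1) :
    ENNReal.ofReal t * ∫⁻ ω, ‖f ω‖ₑ ∂P ≤ rearrangementIntegral P f t := by
  rw [← excess_zero_eq, excess_eq_lintegral hf, rearrangementIntegral_eq,
    ← lintegral_const_mul' _ _ ENNReal.ofReal_ne_top]
  refine lintegral_mono fun s => le_min ?_ ?_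
  · exact mul_le_of_le_one_right' prob_le_one
  · exact mul_le_of_le_one_left' (by simpa using ht1)

theorem rearrangementIntegral_eq_of_one_le [IsProbabilityMeasure P] (f : Ω → ℝ) {t : ℝ}
    (ht : 1 ≤ t) : rearrangementIntegral P f t = rearrangementIntegral P f 1 := by
  rw [rearrangementIntegral_eq, rearrangementIntegral_eq]
  refine lintegral_congr fun s => ?_
  have h1 : P {ω | s < |f ω|} ≤ 1 := prob_le_one
  rw [ENNReal.ofReal_one, min_eq_right h1, min_eq_right (h1.trans (by simpa using ht))]

theorem rearrangementIntegral_mono (h : ∀ᵐ ω ∂P, |f ω| ≤ |g ω|) (t : ℝ) :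
    rearrangementIntegral P f t ≤ rearrangementIntegral P g t := by
  rw [rearrangementIntegral_eq, rearrangementIntegral_eq]
  refine lintegral_mono fun s => min_le_min_left _ (measure_mono_ae ?_)
  filter_upwards [h] with ω h hω using lt_of_lt_of_le hω h

theorem rearrangementIntegral_smul [IsProbabilityMeasure P] (a : ℝ) (hf : AEMeasurable f P)
    {t : ℝ} (ht : 0 < t) :
    rearrangementIntegral P (a • f) t = ‖a‖ₑ * rearrangementIntegral P f t := by
  have key (a : ℝ) {f : Ω → ℝ} (hf : AEMeasurable f P) :
      rearrangementIntegral P (a • f) t ≤ ‖a‖ₑ * rearrangementIntegral P f t := by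
    obtain ⟨r, hr, h1, h2⟩ := exists_upper_quantile hf ht
    rw [rearrangementIntegral_eq_add_excess hf hr h1 h2, mul_add, Real.enorm_eq_ofReal_abs,
      ← excess_smul (abs_nonneg a), ← mul_assoc, ← ENNReal.ofReal_mul (abs_nonneg a)]
    refine (rearrangementIntegral_le (hf.const_smul a) (r := |a| * r) (by positivity) t).trans_eq ?_
    simp [excess, abs_mul]
  rcases eq_or_ne a 0 with rfl | ha
  · exact le_antisymm (key 0 hf) (by simp)
  refine le_antisymm (key a hf) ?_
  have h := mul_le_mul_right (key a⁻¹ (hf.const_smul a)) ‖a‖ₑ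
  rwa [inv_smul_smul₀ ha, ← mul_assoc, ← enorm_mul, mul_inv_cancel₀ ha, enorm_one, one_mul] at h

/-- Optimal levels r for f and s for g make r + s a competitor for f + g, and (|f + g| - r - s)₊ ≤
(|f| - r)₊ + (|g| - s)₊. -/
theorem rearrangementIntegral_add_le [IsProbabilityMeasure P] (hf : AEMeasurable f P)
    (hg : AEMeasurable g P) {t : ℝ} (ht : 0 < t) :
    rearrangementIntegral P (f + g) t ≤
      rearrangementIntegral P f t + rearrangementIntegral P g t := by
  obtain ⟨r, hr, h1, h2⟩ := exists_upper_quantile hf ht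
  obtain ⟨s, hs, h3, h4⟩ := exists_upper_quantile hg ht
  rw [rearrangementIntegral_eq_add_excess hf hr h1 h2,
    rearrangementIntegral_eq_add_excess hg hs h3 h4]
  refine (rearrangementIntegral_le (hf.add hg) (add_nonneg hr hs) t).trans ?_
  have : excess P (f + g) (r + s) ≤ excess P f r + excess P g s := by
    rw [excess, excess, excess, ← lintegral_add_left' (by fun_prop)]
    refine lintegral_mono fun ω => le_trans (ENNReal.ofReal_le_ofReal ?_) ENNReal.ofReal_add_le
    have := abs_add_le (f ω) (g ω)
    simp only [Pi.add_apply]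
    linarith
  rw [ENNReal.ofReal_add hr hs, add_mul, add_add_add_comm]
  gcongr

/-- The extremal function in the dual description of `∫₀ᵗ f*`. -/
theorem exists_lintegral_eq_rearrangementIntegral [IsProbabilityMeasure P] (hf : AEMeasurable f P)
    {t : ℝ} (ht : 0 < t) (ht1 : t ≤ 1) :
    ∃ g : Ω → ℝ, AEMeasurable g P ∧ associate P (fun h => rearrangementIntegral P h t) g ≤ 1 ∧
      rearrangementIntegral P f t ≤ ∫⁻ ω, ‖g ω * f ω‖ₑ ∂P := by
  obtain ⟨r, hr, h1, h2⟩ := exists_upper_quantile hf ht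
  have h2' : ENNReal.ofReal t ≤ P {ω | r ≤ |f ω|} := by
    rcases h2 with rfl | h2
    · simpa using ht1
    · exact h2
  have hf' : AEMeasurable (fun ω => |f ω|) P := by fun_prop
  set A := {ω | r < |f ω|}
  set B := {ω | |f ω| = r}
  have hA : NullMeasurableSet A P := hf'.nullMeasurable measurableSet_Ioi
  have hB : NullMeasurableSet B P := hf'.nullMeasurable (measurableSet_singleton r)
  have hAB : P {ω | r ≤ |f ω|} = P A + P B := by
    rw [← measure_union₀ hB]
    · congr 1; ext ω; simp [A, B, le_iff_lt_or_eq, eq_comm]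
    · refine Disjoint.aedisjoint (Set.disjoint_left.2 fun ω h h' => ?_)
      exact (show r < |f ω| from h).ne' h'
  rw [hAB] at h2'
  -- The extremal g is 1 on {|f| > r} and θ on {|f| = r}, with θ chosen so that E g = t.
  obtain ⟨θ, hθ1, hθ⟩ : ∃ θ : ℝ≥0∞, θ ≤ 1 ∧ P A + θ * P B = ENNReal.ofReal t := by
    rcases eq_or_ne (P B) 0 with h0 | h0
    · exact ⟨0, zero_le, by rw [h0] at h2'; simpa using le_antisymm h1 (by simpa using h2')⟩
    · refine ⟨(ENNReal.ofReal t - P A) / P B, ?_, ?_⟩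
      · rw [ENNReal.div_le_iff_le_mul (Or.inl h0) (Or.inl (measure_ne_top _ _)), one_mul]
        exact tsub_le_iff_left.2 h2'
      · rw [ENNReal.div_mul_cancel h0 (measure_ne_top _ _), add_tsub_cancel_of_le h1]
  have hθ' : ENNReal.ofReal θ.toReal = θ := ENNReal.ofReal_toReal (hθ1.trans_lt (by simp)).ne
  have hθ1' : θ.toReal ≤ 1 := ENNReal.toReal_le_of_le_ofReal zero_le_one (by simpa using hθ1)
  set h : ℝ → ℝ := fun x => if r < x then 1 else if x = r then θ.toReal else 0 with hh
  have hm : Measurable h := Measurable.ite measurableSet_Ioi measurable_const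
    (Measurable.ite (measurableSet_singleton r) measurable_const measurable_const)
  have hgm : AEMeasurable (fun ω => h |f ω|) P := hm.comp_aemeasurable hf'
  have hg0 (x : ℝ) : 0 ≤ h x := by simp only [hh]; split_ifs <;> simp
  have hg1 (x : ℝ) : h x ≤ 1 := by simp only [hh]; split_ifs <;> simp [hθ1']
  have hgint : ∫⁻ ω, ENNReal.ofReal (h |f ω|) ∂P = ENNReal.ofReal t := by
    have : ∀ ω, ENNReal.ofReal (h |f ω|) =
        A.indicator (fun _ => 1) ω + B.indicator (fun _ => θ) ω := by
      intro ω
      rcases lt_trichotomy r |f ω| with h' | h' | h'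
      · simp [hh, h', A, B, h'.ne']
      · simp [hh, h'.symm, A, B, hθ']
      · simp [hh, h'.not_gt, A, B, h'.ne]
    simp_rw [this]
    rw [lintegral_add_left' (aemeasurable_const.indicator₀ hA), lintegral_indicator_const₀ hA,
      lintegral_indicator_const₀ hB, one_mul, hθ]
  refine ⟨fun ω => h |f ω|, hgm, ?_, ?_⟩
  -- Since 0 ≤ g ≤ 1, |k|g ≤ sg + (|k| - s)₊; with E g = t and s the t-quantile of k, the right side
  -- integrates to ∫₀ᵗ k*.
  · refine iSup_le fun k => iSup_le fun hk => iSup_le fun hk1 => le_trans ?_ hk1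
    obtain ⟨s, hs, h3, h4⟩ := exists_upper_quantile hk ht
    beta_reduce
    rw [rearrangementIntegral_eq_add_excess hk hs h3 h4, ← hgint,
      ← lintegral_const_mul' _ _ ENNReal.ofReal_ne_top, excess,
      ← lintegral_add_left' (by fun_prop)]
    refine lintegral_mono fun ω => ?_
    rw [← ENNReal.ofReal_mul hs, Real.enorm_eq_ofReal_abs, abs_mul, abs_of_nonneg (hg0 _)]
    rcases le_total 0 (|k ω| - s) with h' | h'
    · rw [← ENNReal.ofReal_add (mul_nonneg hs (hg0 _)) h']
      exact ENNReal.ofReal_le_ofReal (by nlinarith [hg1 |f ω|])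
    · rw [ENNReal.ofReal_of_nonpos h', add_zero]
      exact ENNReal.ofReal_le_ofReal (by nlinarith [hg0 |f ω|])
  · rw [rearrangementIntegral_eq_add_excess hf hr h1 h2, ← hgint,
      ← lintegral_const_mul' _ _ ENNReal.ofReal_ne_top, excess,
      ← lintegral_add_left' (by fun_prop)]
    refine lintegral_mono fun ω => ?_
    rw [← ENNReal.ofReal_mul hr, Real.enorm_eq_ofReal_abs, abs_mul, abs_of_nonneg (hg0 _)]
    rcases lt_or_ge r |f ω| with h' | h'
    · rw [← ENNReal.ofReal_add (mul_nonneg hr (hg0 _)) (by linarith)]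
      simp [hh, h']
    · rw [ENNReal.ofReal_of_nonpos (p := |f ω| - r) (by linarith), add_zero]
      refine ENNReal.ofReal_le_ofReal ?_
      rcases h'.eq_or_lt with h' | h'
      · rw [h', mul_comm]
      · simp [hh, h'.ne, h'.not_gt]

/-- Hölder's inequality by normalizing f; definiteness handles N f = 0. -/
theorem lintegral_enorm_mul_le_mul_associate {N : (Ω → ℝ) → ℝ≥0∞}
    (hdef : ∀ f, AEMeasurable f P → N f = 0 → f =ᵐ[P] 0)
    (hsmul : ∀ (a : ℝ) f, AEMeasurable f P → N (a • f) = ‖a‖ₑ * N f)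
    (hf : AEMeasurable f P) (hN : N f ≠ ∞) (g : Ω → ℝ) :
    ∫⁻ ω, ‖f ω * g ω‖ₑ ∂P ≤ N f * associate P N g := by
  rcases eq_or_ne (N f) 0 with h0 | h0
  · have : ∫⁻ ω, ‖f ω * g ω‖ₑ ∂P = 0 := by
      rw [lintegral_congr_ae (g := fun _ => 0)]
      · simp
      · filter_upwards [hdef f hf h0] with ω hω
        simp [hω]
    rw [this]
    exact zero_le
  set c := (N f).toReal
  have hc : 0 < c := ENNReal.toReal_pos h0 hN
  have hcN : ‖c‖ₑ = N f := by
    rw [Real.enorm_eq_ofReal hc.le, ENNReal.ofReal_toReal hN]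
  have h1 : N (c⁻¹ • f) ≤ 1 := by
    rw [hsmul _ _ hf, enorm_inv hc.ne', hcN, ENNReal.inv_mul_cancel h0 hN]
  have h2 : ∫⁻ ω, ‖(c⁻¹ • f) ω * g ω‖ₑ ∂P ≤ associate P N g :=
    le_iSup_of_le (c⁻¹ • f) (le_iSup_of_le (hf.const_smul _) (le_iSup_of_le h1 le_rfl))
  calc ∫⁻ ω, ‖f ω * g ω‖ₑ ∂P = N f * ∫⁻ ω, ‖(c⁻¹ • f) ω * g ω‖ₑ ∂P := by
        rw [← lintegral_const_mul' _ _ hN]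
        refine lintegral_congr fun ω => ?_
        rw [← hcN, ← enorm_mul, Pi.smul_apply, smul_eq_mul]
        congr 1
        field_simp
    _ ≤ _ := by gcongr

theorem associate_associate_le {N : (Ω → ℝ) → ℝ≥0∞}
    (hdef : ∀ f, AEMeasurable f P → N f = 0 → f =ᵐ[P] 0)
    (hsmul : ∀ (a : ℝ) f, AEMeasurable f P → N (a • f) = ‖a‖ₑ * N f)
    (hf : AEMeasurable f P) : associate P (associate P N) f ≤ N f := by
  rcases eq_or_ne (N f) ∞ with hN | hN
  · rw [hN]; exact le_top
  refine iSup_le fun g => iSup_le fun hg => iSup_le fun hg1 => ?_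
  calc ∫⁻ ω, ‖g ω * f ω‖ₑ ∂P = ∫⁻ ω, ‖f ω * g ω‖ₑ ∂P := by simp_rw [mul_comm]
    _ ≤ N f * associate P N g := lintegral_enorm_mul_le_mul_associate hdef hsmul hf hN g
    _ ≤ N f := mul_le_of_le_one_right' hg1

theorem exists_tendsto_of_cauchy_lintegral {f : ℕ → Ω → ℝ} (hf : ∀ n, AEMeasurable (f n) P)
    (hfin : ∀ n, ∫⁻ ω, ‖f n ω‖ₑ ∂P < ∞)
    (hc : ∀ ε : ℝ≥0∞, 0 < ε → ∃ K, ∀ m ≥ K, ∀ n ≥ K, ∫⁻ ω, ‖f m ω - f n ω‖ₑ ∂P < ε) :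
    ∃ g, AEMeasurable g P ∧ Tendsto (fun n => ∫⁻ ω, ‖f n ω - g ω‖ₑ ∂P) atTop (𝓝 0) := by
  have hL (n) : MemLp (f n) 1 P :=
    ⟨(hf n).aestronglyMeasurable, by rw [eLpNorm_one_eq_lintegral_enorm]; exact hfin n⟩
  have hC : CauchySeq fun n => (hL n).toLp (f n) := by
    refine EMetric.cauchySeq_iff.2 fun ε hε => ?_
    obtain ⟨K, hK⟩ := hc ε hε
    refine ⟨K, fun m hm n hn => ?_⟩
    rw [Lp.edist_toLp_toLp, eLpNorm_one_eq_lintegral_enorm]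
    exact hK m hm n hn
  obtain ⟨G, hG⟩ := cauchySeq_tendsto_of_complete hC
  refine ⟨G, (Lp.memLp G).1.aemeasurable, ?_⟩
  have := (Lp.tendsto_Lp_iff_tendsto_eLpNorm'' f hL G (Lp.memLp G)).1 (by simpa using hG)
  simpa [eLpNorm_one_eq_lintegral_enorm] using this

/-- Completeness and the embeddings come from equivalence with the `L¹` norm; the extremal function
shows that the norm is at most its second associate, giving both norming and maximality. -/
theorem isRINorm_rearrangementIntegral [IsProbabilityMeasure P] {t : ℝ} (ht : 0 < t)
    (ht1 : t ≤ 1) : IsRINorm P fun f => rearrangementIntegral P f t := by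
  have ht0 : ENNReal.ofReal t ≠ 0 := by simpa using ht
  have hlow (f : Ω → ℝ) (hf : AEMeasurable f P) :
      ∫⁻ ω, ‖f ω‖ₑ ∂P ≤ rearrangementIntegral P f t / ENNReal.ofReal t := by
    rw [ENNReal.le_div_iff_mul_le (Or.inl ht0) (Or.inl ENNReal.ofReal_ne_top), mul_comm]
    exact mul_lintegral_le_rearrangementIntegral hf ht1
  have hdef : ∀ f, AEMeasurable f P → rearrangementIntegral P f t = 0 → f =ᵐ[P] 0 := by
    intro f hf h0
    have := hlow f hf
    rw [h0, ENNReal.zero_div, nonpos_iff_eq_zero, lintegral_eq_zero_iff' hf.enorm] at this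
    filter_upwards [this] with ω hω using by simpa using hω
  have hsmul : ∀ (a : ℝ) f, AEMeasurable f P →
      rearrangementIntegral P (a • f) t = ‖a‖ₑ * rearrangementIntegral P f t :=
    fun a f hf => rearrangementIntegral_smul a hf ht
  have hle (f : Ω → ℝ) (hf : AEMeasurable f P) : rearrangementIntegral P f t ≤
      associate P (associate P fun f => rearrangementIntegral P f t) f := by
    obtain ⟨g, hg, hg1, h⟩ := exists_lintegral_eq_rearrangementIntegral hf ht ht1
    exact le_iSup_of_le g (le_iSup_of_le hg (le_iSup_of_le hg1 h))
  refine ⟨hdef, hsmul, fun f g hf hg => rearrangementIntegral_add_le hf hg ht,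
    fun f g _ _ h => rearrangementIntegral_mono h t, fun f hf hfin hc => ?_, fun f g h => ?_,
    ?_, ?_, fun f hf _ => ?_, Or.inl fun f hf h => (hle f hf).trans_lt h⟩
  · obtain ⟨g, hg, hlim⟩ := exists_tendsto_of_cauchy_lintegral hf
      (fun n => (hlow _ (hf n)).trans_lt (ENNReal.div_lt_top (hfin n).ne ht0)) fun ε hε => by
        obtain ⟨K, hK⟩ := hc (ε * ENNReal.ofReal t) (ENNReal.mul_pos hε.ne' ht0)
        refine ⟨K, fun m hm n hn => (hlow _ ((hf m).sub (hf n))).trans_lt ?_⟩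
        exact ENNReal.div_lt_of_lt_mul (hK m hm n hn)
    exact ⟨g, hg, tendsto_of_tendsto_of_tendsto_of_le_of_le tendsto_const_nhds hlim
      (fun _ => zero_le) fun n => rearrangementIntegral_le_lintegral ((hf n).sub hg) t⟩
  · simp only [rearrangementIntegral_eq]
    refine lintegral_congr fun s => ?_
    congr 1
    exact h.measure_mem_eq (s := {x : ℝ | s < |x|})
      (measurableSet_lt measurable_const (by fun_prop))
  · refine (rearrangementIntegral_le_lintegral aemeasurable_const t).trans_lt ?_
    simp
  · refine ⟨(Real.toNNReal t)⁻¹, fun f hf => (hlow f hf).trans_eq ?_⟩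
    rw [ENNReal.coe_inv (by simpa using ht), ENNReal.div_eq_inv_mul]
    rfl
  · exact le_antisymm (hle f hf) (associate_associate_le hdef hsmul hf)

theorem isSeparableNorm_rearrangementIntegral [IsProbabilityMeasure P] [IsSeparable P] {t : ℝ}
    (ht : 0 < t) (ht1 : t ≤ 1) : IsSeparableNorm P fun f => rearrangementIntegral P f t := by
  have : Fact ((1 : ℝ≥0∞) ≠ ∞) := ⟨by simp⟩
  obtain ⟨D, hDc, hD⟩ := TopologicalSpace.exists_countable_dense (Lp ℝ 1 P)
  have hN (G : Lp ℝ 1 P) : AEMeasurable G P := (Lp.memLp G).1.aemeasurable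
  refine ⟨(fun G : Lp ℝ 1 P => (G : Ω → ℝ)) '' D, hDc.image _, ?_, fun f hf hfin ε hε => ?_⟩
  · rintro _ ⟨G, -, rfl⟩
    refine ⟨hN G, (rearrangementIntegral_le_lintegral (hN G) t).trans_lt ?_⟩
    rw [← eLpNorm_one_eq_lintegral_enorm]
    exact (Lp.memLp G).2
  · have hL : MemLp f 1 P := by
      refine ⟨hf.aestronglyMeasurable, ?_⟩
      rw [eLpNorm_one_eq_lintegral_enorm]
      have := (mul_lintegral_le_rearrangementIntegral hf ht1).trans_lt hfin
      exact ENNReal.lt_top_of_mul_ne_top_right this.ne (by simpa using ht)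
    obtain ⟨G, hGD, hG⟩ := EMetric.mem_closure_iff.1 (hD (hL.toLp f)) ε hε
    refine ⟨G, ⟨G, hGD, rfl⟩, ?_⟩
    refine (rearrangementIntegral_le_lintegral (hf.sub (hN G)) t).trans_lt ?_
    have h2 := Lp.edist_toLp_toLp f G hL (Lp.memLp G)
    rw [Lp.toLp_coeFn, eLpNorm_one_eq_lintegral_enorm] at h2
    rwa [h2] at hG

end RearrangementIntegral

section Norms

variable {P : Measure Ω} {f g X Z : Ω → ℝ} {N : (Ω → ℝ) → ℝ≥0∞}

/-! ### Rearrangement invariant norms and weak domination -/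

/-- For g in the associate unit ball, replace X by the rearrangement Y of |Z| comonotone with |g|;
then E|Yg| ≤ N(Y) = N(|Z|) ≤ N(Z). -/
theorem WeaklyDominated.associate_associate_le [IsProbabilityMeasure P]
    (hP : CarriesIndependentSequences P) (hN : IsRINorm P N) (hX : AEMeasurable X P)
    (hZ : AEMeasurable Z P) (h : WeaklyDominated P X Z) :
    associate P (associate P N) X ≤ N Z := by
  rcases eq_or_ne (N Z) ∞ with hZN | hZN
  · rw [hZN]; exact le_top
  refine iSup_le fun g => iSup_le fun hg => iSup_le fun hg1 => ?_
  obtain ⟨Y, hY, hid, hle⟩ := h.exists_lintegral_mul_le hP hX hZ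
    (g := fun ω => |hg.mk g ω|) (measurable_abs.comp hg.measurable_mk) fun ω => abs_nonneg _
  have hmk (V : Ω → ℝ) : ∫⁻ ω, ‖V ω‖ₑ * ENNReal.ofReal |hg.mk g ω| ∂P = ∫⁻ ω, ‖V ω * g ω‖ₑ ∂P := by
    refine lintegral_congr_ae (hg.ae_eq_mk.mono fun ω hω => ?_)
    simp only [enorm_mul, ← hω, Real.enorm_eq_ofReal_abs]
  have hYN : N Y ≤ N Z := by
    rw [hN.rearrangement_invariant _ _ hid]
    exact hN.mono _ _ (by fun_prop) hZ (ae_of_all _ fun ω => (abs_abs _).le)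
  calc ∫⁻ ω, ‖g ω * X ω‖ₑ ∂P = ∫⁻ ω, ‖X ω‖ₑ * ENNReal.ofReal |hg.mk g ω| ∂P := by
        rw [hmk]; simp_rw [mul_comm]
    _ ≤ ∫⁻ ω, ‖Y ω * g ω‖ₑ ∂P := hle.trans_eq (hmk Y)
    _ ≤ N Y * associate P N g := lintegral_enorm_mul_le_mul_associate hN.definite hN.smul
        hY.aemeasurable (hYN.trans_lt hZN.lt_top).ne g
    _ ≤ N Z := (mul_le_of_le_one_right' hg1).trans hYN

theorem IsRINorm.lt_top_of_bounded (hN : IsRINorm P N) (hf : AEMeasurable f P) {C : ℝ}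
    (hC : ∀ᵐ ω ∂P, |f ω| ≤ C) : N f < ∞ := by
  refine (hN.mono f (C • fun _ => 1) hf (by fun_prop) ?_).trans_lt ?_
  · filter_upwards [hC] with ω h
    simpa using h.trans (le_abs_self C)
  · rw [hN.smul _ _ aemeasurable_const]
    exact ENNReal.mul_lt_top (by simp) hN.one_lt_top

theorem WeaklyDominated.tail (h : WeaklyDominated P X Z) {K : ℝ} (hK : 0 ≤ K) :
    WeaklyDominated P (fun ω => max (|X ω| - K) 0) (fun ω => max (|Z ω| - K) 0) := fun r hr => by
  have (V : Ω → ℝ) : excess P (fun ω => max (|V ω| - K) 0) r = excess P V (K + r) := by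
    refine lintegral_congr fun ω => ?_
    rw [abs_of_nonneg (le_max_right _ _), ← sub_sub]
    beta_reduce
    rcases le_total (|V ω| - K) 0 with h | h
    · rw [max_eq_right h, ENNReal.ofReal_of_nonpos (by linarith),
        ENNReal.ofReal_of_nonpos (by linarith)]
    · rw [max_eq_left h]
  rw [this, this]
  exact h _ (add_nonneg hK hr)

/-- A simple s approximating Z is bounded by some K, and then (|Z| - K)₊ ≤ |Z - s|. -/
theorem IsRINorm.exists_tail_lt (hN : IsRINorm P N)
    (hs : ∀ f, AEMeasurable f P → N f < ∞ → ∀ ε : ℝ≥0∞, 0 < ε →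
      ∃ s : SimpleFunc Ω ℝ, N (f - s) < ε)
    (hZ : AEMeasurable Z P) (hZN : N Z < ∞) {ε : ℝ≥0∞} (hε : 0 < ε) :
    ∃ K : ℕ, N (fun ω => max (|Z ω| - K) 0) < ε := by
  obtain ⟨s, hs⟩ := hs Z hZ hZN ε hε
  obtain ⟨C, hC⟩ := s.exists_forall_norm_le
  obtain ⟨K, hK⟩ := exists_nat_ge C
  refine ⟨K, (hN.mono _ _ (by fun_prop) (hZ.sub s.measurable.aemeasurable)
    (ae_of_all _ fun ω => ?_)).trans_lt hs⟩
  rw [abs_of_nonneg (le_max_right _ _)]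
  refine max_le ?_ (abs_nonneg _)
  have h1 : |s ω| ≤ C := hC ω
  have h2 := abs_sub_abs_le_abs_sub (Z ω) (s ω)
  simp only [Pi.sub_apply]
  linarith

theorem abs_min_sub_min_le {x K m n : ℝ} (hm : K ≤ m) (hn : K ≤ n) :
    |min x m - min x n| ≤ max (x - K) 0 := by
  rw [abs_sub_le_iff]
  rcases le_total x m with h1 | h1 <;> rcases le_total x n with h2 | h2 <;>
    simp [h1, h2] <;> grind

/-- Rearrangement invariant norms are monotone for weak domination. -/
theorem WeaklyDominated.riNorm_le [IsProbabilityMeasure P] (hP : CarriesIndependentSequences P)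
    (hN : IsRINorm P N) (hX : AEMeasurable X P) (hZ : AEMeasurable Z P)
    (h : WeaklyDominated P X Z) : N X ≤ N Z := by
  have hle := h.associate_associate_le hP hN hX hZ
  rcases eq_or_ne (N Z) ∞ with hZN | hZN
  · rw [hZN]; exact le_top
  -- The norm equals its second associate only on L, so it remains to place X in L. Maximality does
  -- this at once; in the minimal case truncations of |X| must be shown to converge.
  suffices hfin : N X < ∞ by rwa [hN.norming X hX hfin]
  rcases hN.maximal_or_minimal with hmax | hmin
  · exact hmax X hX (hle.trans_lt hZN.lt_top)
  set V : ℕ → Ω → ℝ := fun n ω => min |X ω| n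
  have hV (n : ℕ) : AEMeasurable (V n) P := by fun_prop
  have hVb (n : ℕ) (ω : Ω) : |V n ω| ≤ n := by
    rw [abs_of_nonneg (le_min (abs_nonneg _) n.cast_nonneg)]
    exact min_le_right _ _
  have hVN (n : ℕ) : N (V n) < ∞ := hN.lt_top_of_bounded (hV n) (ae_of_all _ (hVb n))
  obtain ⟨G, hG, hlim⟩ := hN.complete V hV hVN fun ε hε => by
    obtain ⟨K, hK⟩ := hN.exists_tail_lt hmin hZ hZN.lt_top hε
    refine ⟨K, fun m hm n hn => lt_of_le_of_lt ?_ hK⟩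
    have hmn : AEMeasurable (V m - V n) P := (hV m).sub (hV n)
    rw [hN.norming _ hmn (hN.lt_top_of_bounded hmn (C := m + n) (ae_of_all _ fun ω =>
      (abs_sub _ _).trans (add_le_add (hVb m ω) (hVb n ω))))]
    -- Differences of truncations beyond K are bounded by (|X| - K)₊, which is weakly dominated by
    -- the small tail (|Z| - K)₊.
    refine ((h.tail K.cast_nonneg).mono_left (ae_of_all _ fun ω => ?_)).associate_associate_le hP
      hN hmn (by fun_prop)
    rw [abs_of_nonneg (le_max_right (|X ω| - _) _)]
    exact abs_min_sub_min_le (by exact_mod_cast hm) (by exact_mod_cast hn)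
  obtain ⟨C, hC⟩ := hN.embeds_L1
  -- Convergence in N implies convergence in `L¹`; Fatou identifies the limit.
  have hGX : ∀ᵐ ω ∂P, |X ω| = G ω := by
    have hev (ω : Ω) : ∀ᶠ n : ℕ in atTop, V n ω = |X ω| := by
      obtain ⟨K, hK⟩ := exists_nat_ge |X ω|
      filter_upwards [eventually_ge_atTop K] with n hn
      exact min_eq_left (hK.trans (by exact_mod_cast hn))
    have h0 : ∫⁻ ω, ‖|X ω| - G ω‖ₑ ∂P = 0 := by
      refine nonpos_iff_eq_zero.1 ?_
      calc ∫⁻ ω, ‖|X ω| - G ω‖ₑ ∂P = ∫⁻ ω, liminf (fun n => ‖V n ω - G ω‖ₑ) atTop ∂P := by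
            refine lintegral_congr fun ω => (Tendsto.liminf_eq ?_).symm
            exact tendsto_const_nhds.congr' ((hev ω).mono fun n hn => by beta_reduce; rw [hn])
        _ ≤ liminf (fun n => ∫⁻ ω, ‖V n ω - G ω‖ₑ ∂P) atTop :=
            lintegral_liminf_le' fun n => ((hV n).sub hG).enorm
        _ = 0 := by
            refine Tendsto.liminf_eq (tendsto_of_tendsto_of_tendsto_of_le_of_le tendsto_const_nhds
              (?_ : Tendsto (fun n => C * N (V n - G)) atTop (𝓝 0)) (fun _ => zero_le)
              fun n => hC _ ((hV n).sub hG))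
            simpa using ENNReal.Tendsto.const_mul hlim (Or.inr ENNReal.coe_ne_top)
    rw [lintegral_eq_zero_iff' (by fun_prop)] at h0
    filter_upwards [h0] with ω hω
    simpa [sub_eq_zero] using hω
  obtain ⟨n, hn⟩ := (hlim.eventually (gt_mem_nhds ENNReal.zero_lt_top)).exists
  have hn' : N ((-1 : ℝ) • (V n - G)) < ∞ := by
    rw [hN.smul _ _ ((hV n).sub hG)]
    exact ENNReal.mul_lt_top (by simp) hn
  refine (hN.mono X (V n + (-1 : ℝ) • (V n - G)) hX (by fun_prop) ?_).trans_lt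
    ((hN.triangle _ _ (hV n) (by fun_prop)).trans_lt (ENNReal.add_lt_top.2 ⟨hVN n, hn'⟩))
  filter_upwards [hGX] with ω hω
  simp [← hω]

/-! ### The domination constants -/

variable {ξ η : Ω → ℝ}

theorem mem_maximalConstants_iff [IsProbabilityMeasure P] (hξ : AEMeasurable ξ P)
    (hη : AEMeasurable η P) (c : ℝ≥0) :
    c ∈ maximalConstants P ξ η ↔ WeaklyDominated P ξ ((c : ℝ) • η) := by
  rw [weaklyDominated_iff_rearrangementIntegral_le hξ (hη.const_smul _)]
  refine forall₂_congr fun t ht => ?_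
  have ht0 : ENNReal.ofReal t ≠ 0 := by simpa using ht
  rw [rearrangementIntegral_smul _ hη ht, maximalFunction, maximalFunction, ← mul_div_assoc,
    ENNReal.div_le_iff_le_mul (Or.inl ht0) (Or.inl ENNReal.ofReal_ne_top),
    ENNReal.div_mul_cancel ht0 ENNReal.ofReal_ne_top, Real.enorm_eq_ofReal c.coe_nonneg,
    ENNReal.ofReal_coe_nnreal]
  rfl

theorem orliczConstants_eq [IsProbabilityMeasure P] (hP : CarriesIndependentSequences P)
    (hξ : AEMeasurable ξ P) (hη : AEMeasurable η P) :
    orliczConstants P ξ η = maximalConstants P ξ η := by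
  ext c
  rw [mem_maximalConstants_iff hξ hη]
  refine ⟨fun h => weaklyDominated_of_specialOrlicz_le fun t ht => ?_, fun h φ hφ => ?_⟩
  · have hφ := isOrliczFunction_specialOrlicz ht
    rw [orliczNorm_smul hφ.map_zero]
    exact h _ hφ
  · rw [← orliczNorm_smul hφ.map_zero]
    exact h.orliczNorm_le hP hξ (hη.const_smul _) hφ

theorem specialOrliczConstants_eq [IsProbabilityMeasure P] (hP : CarriesIndependentSequences P)
    (hξ : AEMeasurable ξ P) (hη : AEMeasurable η P) :
    specialOrliczConstants P ξ η = maximalConstants P ξ η := by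
  refine subset_antisymm (fun c h => ?_) ?_
  · rw [mem_maximalConstants_iff hξ hη]
    refine weaklyDominated_of_specialOrlicz_le fun t ht => ?_
    rw [orliczNorm_smul (isOrliczFunction_specialOrlicz ht).map_zero]
    exact h t ht
  · rw [← orliczConstants_eq hP hξ hη]
    exact fun c h t ht => h _ (isOrliczFunction_specialOrlicz ht)

theorem maximalConstants_subset_riConstants [IsProbabilityMeasure P]
    (hP : CarriesIndependentSequences P) (hξ : AEMeasurable ξ P) (hη : AEMeasurable η P) :
    maximalConstants P ξ η ⊆ riConstants P ξ η := fun c h N hN => by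
  rw [mem_maximalConstants_iff hξ hη] at h
  have := h.riNorm_le hP hN hξ (hη.const_smul _)
  rwa [hN.smul _ _ hη, Real.enorm_eq_ofReal c.coe_nonneg, ENNReal.ofReal_coe_nnreal] at this

/-- Test on the norms f ↦ ∫₀ᵗ f* with t ≤ 1; beyond t = 1 the integral is constant, as f* vanishes
there. -/
theorem separableRIConstants_subset_maximalConstants [IsProbabilityMeasure P] [IsSeparable P]
    (hξ : AEMeasurable ξ P) (hη : AEMeasurable η P) :
    separableRIConstants P ξ η ⊆ maximalConstants P ξ η := fun c h => by
  rw [mem_maximalConstants_iff hξ hη,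
    weaklyDominated_iff_rearrangementIntegral_le hξ (hη.const_smul _)]
  have key (t : ℝ) (ht : 0 < t) (ht1 : t ≤ 1) :
      rearrangementIntegral P ξ t ≤ rearrangementIntegral P ((c : ℝ) • η) t := by
    rw [rearrangementIntegral_smul _ hη ht, Real.enorm_eq_ofReal c.coe_nonneg,
      ENNReal.ofReal_coe_nnreal]
    exact h _ (isRINorm_rearrangementIntegral ht ht1) (isSeparableNorm_rearrangementIntegral ht ht1)
  intro t ht
  rcases le_total t 1 with ht1 | ht1
  · exact key t ht ht1
  · rw [rearrangementIntegral_eq_of_one_le _ ht1, rearrangementIntegral_eq_of_one_le _ ht1]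
    exact key 1 one_pos le_rfl

theorem riConstants_eq [IsProbabilityMeasure P] [IsSeparable P]
    (hP : CarriesIndependentSequences P) (hξ : AEMeasurable ξ P) (hη : AEMeasurable η P) :
    riConstants P ξ η = maximalConstants P ξ η :=
  subset_antisymm (fun _ h => separableRIConstants_subset_maximalConstants hξ hη
    fun N hN _ => h N hN) (maximalConstants_subset_riConstants hP hξ hη)

theorem separableRIConstants_eq [IsProbabilityMeasure P] [IsSeparable P]
    (hP : CarriesIndependentSequences P) (hξ : AEMeasurable ξ P) (hη : AEMeasurable η P) :
    separableRIConstants P ξ η = maximalConstants P ξ η :=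
  subset_antisymm (separableRIConstants_subset_maximalConstants hξ hη)
    fun _ h N hN _ => maximalConstants_subset_riConstants hP hξ hη h N hN

/-- Integrability makes η**(t) finite, so c ↦ c η**(t) is continuous; with η**(t) = ∞ it would jump
at c = 0. Closedness is what makes the infimum attained. -/
theorem isClosed_maximalConstants (hη : Integrable η P) : IsClosed (maximalConstants P ξ η) := by
  have : maximalConstants P ξ η = ⋂ (t : ℝ) (_ : 0 < t),
      {c : ℝ≥0 | maximalFunction P ξ t ≤ c * maximalFunction P η t} := by
    ext c; simp [maximalConstants]
  rw [this]
  refine isClosed_iInter fun t => isClosed_iInter fun ht => isClosed_le continuous_const ?_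
  refine (ENNReal.continuous_mul_const ?_).comp ENNReal.continuous_coe
  refine (ENNReal.div_lt_top ?_ (by simpa using ht)).ne
  exact ((rearrangementIntegral_le_lintegral hη.aemeasurable t).trans_lt hη.2).ne

end Norms

end Domination

open Domination in
theorem mainTheorem9 {Ω : Type*} [MeasurableSpace Ω] (P : Measure Ω) [IsProbabilityMeasure P]
    [IsSeparable P] (hP : CarriesIndependentSequences P) (ξ η : Ω → ℝ)
    (hξ : AEMeasurable ξ P) (hη : AEMeasurable η P)
    (hξ0 : ∀ᵐ ω ∂P, 0 ≤ ξ ω) (hη0 : ∀ᵐ ω ∂P, 0 ≤ η ω) :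
    best (orliczConstants P ξ η) = best (specialOrliczConstants P ξ η) ∧
    best (specialOrliczConstants P ξ η) ≤ best (maximalConstants P ξ η) ∧
    best (maximalConstants P ξ η) = best (riConstants P ξ η) ∧
    best (riConstants P ξ η) = best (separableRIConstants P ξ η) ∧
    best (separableRIConstants P ξ η) ≤ 2 * best (orliczConstants P ξ η) ∧
    (Integrable η P →
      ((orliczConstants P ξ η).Nonempty → ∃ c, IsLeast (orliczConstants P ξ η) c) ∧
      ((specialOrliczConstants P ξ η).Nonempty → ∃ c, IsLeast (specialOrliczConstants P ξ η) c) ∧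
      ((maximalConstants P ξ η).Nonempty → ∃ c, IsLeast (maximalConstants P ξ η) c) ∧
      ((riConstants P ξ η).Nonempty → ∃ c, IsLeast (riConstants P ξ η) c) ∧
      ((separableRIConstants P ξ η).Nonempty →
        ∃ c, IsLeast (separableRIConstants P ξ η) c)) := by
  rw [orliczConstants_eq hP hξ hη, specialOrliczConstants_eq hP hξ hη, riConstants_eq hP hξ hη,
    separableRIConstants_eq hP hξ hη]
  -- All five sets are now the same one, so the factor 2 only has to satisfy x ≤ x + x.
  refine ⟨rfl, le_rfl, rfl, rfl, ?_, fun hint => ?_⟩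
  · rw [two_mul]
    exact le_self_add
  · have h : (maximalConstants P ξ η).Nonempty → ∃ c, IsLeast (maximalConstants P ξ η) c :=
      fun hne => ⟨_, (isClosed_maximalConstants hint).isLeast_csInf hne (OrderBot.bddBelow _)⟩
    exact ⟨h, h, h, h, h⟩
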